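/- Let $G$ be a split, simply connected, semisimple (in particular: almost simple) algebraic group with maximal torus $T$, root datum with character lattice $X=X^*(T)$, simple roots $\Pi$, fundamental weights $\omega_i$ ($i\in\Pi$), $\omega_I=\sum_{i\in I}\omega_i$ for $I\subseteq\Pi$, $\rho=\omega_\Pi$, Weyl group $W$ with length function $\ell$ and longest element $w_0$. For $w\in W$ let $I(w)=\{i\in\Pi : \ell(ws_i)<\ell(w)\}$, let $\overline{I(w)}=\Pi\setminus I(w)$, and let $W_{I}$ be the subgroup generated by $\{s_i\}_{i\in I}$. Let $C'_w=\sum_y P_{y,w}(1)\,y\in\mathbb{Z}[W]$ be the Kazhdan–Lusztig basis, where $P_{y,w}$ are the Kazhdan–Lusztig polynomials. On $N=\mathbb{C}[T]=\mathbb{C}[X]$, with $\mathbb{C}[T]^W$-bilinear pairing $$\langle f,g\rangle=\frac1\delta\sum_{w\in W}(-1)^{\ell(w)}w(fg),\qquad \delta=\sum_{w\in W}(-1)^{\ell(w)}\exp(w\rho),$$ put $$f_w=\frac{1}{|W_{I(w)}|}\,C'_w\bigl(\exp(\omega_{\overline{I(w)}})\bigr)\qquad(w\in W).$$ There is a unique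 family $(f_w^*)_{w\in W}$ in $N$ with $\langle f_v,f_w^*\rangle=\delta_{v,w}$ (the dual basis). Let $q$ be a power (with positive exponent) of a prime, let $[q]^*\exp(\lambda)=\exp(q\lambda)$, and for $w\in W$ put $$M_w=\langle [q]^*f_{w_0d},\,f^*_{w_0w}\rangle ,$$ where $d$ is the Duflo involution in the left Kazhdan–Lusztig cell of $w$, i.e. the element of that cell at which $\ell(d)-2\deg P_{1,d}$ is minimal. For dominant $\lambda\in X$ let $\mathrm{ch}(V_\lambda)=\delta^{-1}\sum_{w}(-1)^{\ell(w)}\exp(w(\lambda+\rho))$ be the Weyl character. Let $(\cdot,\cdot)$ be any $W$-invariant positive definite symmetric bilinear form on $X\otimes\mathbb{R}$, put $h(w)=(\rho,\omega_{I(w)})$, and for $x,y\in X\otimes\mathbb{R}$ write $x\le y$ if $y-x$ is a linear combination of simple roots with nonnegative real coefficients. Then: 1. For every $w\in W$, $M_{w_0w}$ is a finite integer linear combination of Weyl characters $\mathrm{ch}(V_\lambda)$, $\lambda$ dominant, such that $\lambda-(q-1)\omega_{\overline{I(w)}}$ lies in the $W$-orbit of a dominant weight $\gamma\in X$ with $0\le\gamma\le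 2(h(w)+1)\rho$. 2. For every $w\in W$, $M_w$ is a finite integer linear combination of Weyl characters $\mathrm{ch}(V_\lambda)$, $\lambda$ dominant, such that $\lambda-(q-1)\omega_{I(w)}$ lies in the $W$-orbit of a dominant weight $\gamma\in X$ with $0\le\gamma\le k\rho$, where $k=2(\rho,\rho)+2$ depends neither on $w$ nor on $q$. -/

import Mathlib

open scoped TensorProduct

namespace KLS

noncomputable section

variable {ι L L' : Type*} [AddCommGroup L] [AddCommGroup L']

/-! ### Root data, the Weyl group and its length function

`P : RootDatum ι L L'` is the root datum of a split semisimple group `G`: `L` is the character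
lattice `X^*(T)` and `L'` the cocharacter lattice of a split maximal torus `T`. -/

/-- The root datum of a simply connected semisimple group: the coroots span the
cocharacter lattice. -/
class IsSimplyConnected (P : RootDatum ι L L') : Prop where
  span_coroot : Submodule.span ℤ (Set.range P.coroot) = ⊤

/-- The Weyl group is finite: an element is determined by its action on the coroots. -/
instance finite_weylGroup [Finite ι] (P : RootDatum ι L L') [IsSimplyConnected P] :
    Finite P.weylGroup := by
  refine Finite.of_injective (fun w : P.weylGroup => (w : P.Aut).indexEquiv) ?_
  intro w v h
  apply Subtype.ext
  apply RootPairing.Equiv.coweightHom_injective P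
  apply MulOpposite.unop_injective
  apply LinearEquiv.toLinearMap_injective
  refine LinearMap.ext_on_range (IsSimplyConnected.span_coroot (P := P)) fun i => ?_
  have hw := congrFun (w : P.Aut).coroot_coweightMap i
  have hv := congrFun (v : P.Aut).coroot_coweightMap i
  have h' : (w : P.Aut).indexEquiv = (v : P.Aut).indexEquiv := h
  rw [← h'] at hv
  exact hw.trans hv.symm

instance fintype_weylGroup [Finite ι] (P : RootDatum ι L L') [IsSimplyConnected P] :
    Fintype P.weylGroup := Fintype.ofFinite _

/-- A finitely generated free abelian group has the two-unique-sums property, so that its group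
algebra over a field is a domain. -/
instance twoUniqueSums_of_free [Module.Free ℤ L] : TwoUniqueSums L :=
  TwoUniqueSums.of_injective_addHom
    ((Module.Free.chooseBasis ℤ L).repr.toLinearMap.toAddMonoidHom.toAddHom)
    (Module.Free.chooseBasis ℤ L).repr.injective inferInstance

section Coxeter

variable {P : RootDatum ι L L'} (b : P.Base)

/-- The simple reflection attached to a simple root. -/
def simpleRefl (i : b.support) : P.weylGroup := RootPairing.weylGroup.ofIdx P (i : ι)

/-- The length of `w`: the least length of a word in the simple reflections with product `w`. -/
def len (w : P.weylGroup) : ℕ :=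
  sInf {n | ∃ l : List b.support, l.length = n ∧ (l.map (simpleRefl b)).prod = w}

/-- `sgn w = (-1) ^ ℓ(w)`. -/
def sgn (w : P.weylGroup) : ℤ := (-1) ^ len b w

open Classical in
/-- `I(w)`, the set of simple roots `α_s` with `ℓ(w s) < ℓ(w)`. -/
def rightDescent (w : P.weylGroup) : Finset b.support :=
  Finset.univ.filter fun i => len b (w * simpleRefl b i) < len b w

open Classical in
/-- The set of simple roots `α_s` with `ℓ(s w) < ℓ(w)`. -/
def leftDescent (w : P.weylGroup) : Finset b.support :=
  Finset.univ.filter fun i => len b (simpleRefl b i * w) < len b w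

/-- The parabolic subgroup `W_I` generated by the simple reflections in `I`. -/
def parabolic (I : Finset b.support) : Subgroup P.weylGroup :=
  Subgroup.closure (simpleRefl b '' (I : Set b.support))

theorem exists_longest [Finite ι] [IsSimplyConnected P] :
    ∃ w₀ : P.weylGroup, ∀ w, len b w ≤ len b w₀ :=
  Finite.exists_max (len b)

/-- The longest element of the Weyl group. -/
def longest [Finite ι] [IsSimplyConnected P] : P.weylGroup := (exists_longest b).choose

/-! ### Kazhdan-Lusztig polynomials, left cells and Duflo involutions -/

open Classical in
/-- The Kazhdan-Lusztig `R`-polynomial `R_{x,w}`. It is given by `R_{x,1} = δ_{x,1}` and, for a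
right descent `s` of `w`, by `R_{x,w} = R_{xs,ws}` if `xs < x`, and
`R_{x,w} = q R_{xs,ws} + (q-1) R_{x,ws}` if `xs > x`. (The result does not depend on `s`.) -/
def klR (x w : P.weylGroup) : Polynomial ℤ :=
  if h : ∃ i, len b (w * simpleRefl b i) < len b w then
    if len b (x * simpleRefl b h.choose) < len b x then
      klR (x * simpleRefl b h.choose) (w * simpleRefl b h.choose)
    else
      Polynomial.X * klR (x * simpleRefl b h.choose) (w * simpleRefl b h.choose) +
        (Polynomial.X - 1) * klR x (w * simpleRefl b h.choose)
  else if x = 1 then 1 else 0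
termination_by len b w
decreasing_by all_goals exact h.choose_spec

open Classical in
/-- The Kazhdan-Lusztig polynomial `P_{x,w}`. It is determined by `P_{w,w} = 1`, `P_{x,w} = 0` if
`x ≰ w`, `2 deg P_{x,w} < ℓ(w) - ℓ(x)` if `x < w`, and
`q^{ℓ(w)-ℓ(x)} P_{x,w}(q⁻¹) = ∑_{x ≤ y ≤ w} R_{x,y} P_{y,w}`. By the degree bound `-P_{x,w}` is the
part of `∑_{x < y ≤ w} R_{x,y} P_{y,w}` in degrees `k` with `2k < ℓ(w) - ℓ(x)`. -/
def klP [Finite ι] [IsSimplyConnected P] (x w : P.weylGroup) : Polynomial ℤ :=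
  if x = w then 1
  else if len b x < len b w then
    -∑ k ∈ (Finset.range (len b w - len b x)).filter (fun k => 2 * k < len b w - len b x),
      Polynomial.monomial k
        ((∑ y : P.weylGroup,
          if _h : len b x < len b y ∧ len b y ≤ len b w then klR b x y * klP y w else 0).coeff k)
  else 0
termination_by len b w - len b x
decreasing_by omega

/-- The coefficient `μ(x, w)` of degree `(ℓ(w) - ℓ(x) - 1) / 2` in `P_{x,w}` if `ℓ(w) - ℓ(x)` is odd
and positive, and `0` otherwise. -/
def klMu [Finite ι] [IsSimplyConnected P] (x w : P.weylGroup) : ℤ :=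
  open Classical in
  if len b x < len b w ∧ Odd (len b w - len b x) then
    (klP b x w).coeff ((len b w - len b x - 1) / 2)
  else 0

/-- The Kazhdan-Lusztig left preorder `x ≤_L w`: there is a chain from `x` to `w` of elements such
that consecutive `y`, `z` in it are joined in the Kazhdan-Lusztig graph (`μ(y,z) ≠ 0` or
`μ(z,y) ≠ 0`) and the left descent set of `y` is not contained in that of `z`. -/
def leftLE [Finite ι] [IsSimplyConnected P] : P.weylGroup → P.weylGroup → Prop :=
  Relation.ReflTransGen fun y z =>
    (klMu b y z ≠ 0 ∨ klMu b z y ≠ 0) ∧ ¬ leftDescent b y ⊆ leftDescent b z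

/-- `x` and `w` lie in the same left cell. -/
def SameLeftCell [Finite ι] [IsSimplyConnected P] (x w : P.weylGroup) : Prop :=
  leftLE b x w ∧ leftLE b w x

/-- `ℓ(w) - 2 δ(w)`, where `δ(w)` is the degree of `P_{1,w}`. -/
def dufloFun [Finite ι] [IsSimplyConnected P] (w : P.weylGroup) : ℤ :=
  (len b w : ℤ) - 2 * ((klP b 1 w).natDegree : ℤ)

/-- `d` is the Duflo involution of the left cell of `w`: the element of this left cell at which
`ℓ - 2δ` is minimal. -/
def IsDuflo [Finite ι] [IsSimplyConnected P] (d w : P.weylGroup) : Prop :=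
  SameLeftCell b d w ∧ ∀ x, SameLeftCell b x w → dufloFun b d ≤ dufloFun b x

theorem exists_isDuflo [Finite ι] [IsSimplyConnected P] (w : P.weylGroup) :
    ∃ d, IsDuflo b d w := by
  obtain ⟨d, hd, h⟩ := Set.exists_min_image {x | SameLeftCell b x w} (dufloFun b)
    (Set.toFinite _) ⟨w, Relation.ReflTransGen.refl, Relation.ReflTransGen.refl⟩
  exact ⟨d, hd, h⟩

/-! ### Weights -/

theorem linearIndependent_coroot :
    LinearIndependent ℤ (fun i : b.support => P.coroot i) := b.linearIndepOn_coroot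

theorem span_simple_coroot [IsSimplyConnected P] :
    ⊤ ≤ Submodule.span ℤ (Set.range fun i : b.support => P.coroot i) := by
  have h := b.span_int_coroot_support
  rw [IsSimplyConnected.span_coroot, Set.image_eq_range] at h
  exact h.ge

/-- The simple coroots, as a basis of the cocharacter lattice. -/
def corootBasis [IsSimplyConnected P] : Module.Basis b.support ℤ L' :=
  Module.Basis.mk (linearIndependent_coroot b) (span_simple_coroot b)

/-- The fundamental weight `ω_i`. -/
def fundWeight [IsSimplyConnected P] (i : b.support) : L :=
  P.toLinearMap.toPerfPair.symm ((corootBasis b).coord i)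

open Classical in
theorem fundWeight_coroot [IsSimplyConnected P] (i j : b.support) :
    P.toLinearMap (fundWeight b i) (P.coroot j) = if i = j then 1 else 0 := by
  have h : P.coroot j = corootBasis b j := by
    rw [corootBasis, Module.Basis.mk_apply]
  rw [fundWeight, LinearMap.apply_symm_toPerfPair_self, h, Module.Basis.coord_apply,
    Module.Basis.repr_self, Finsupp.single_apply]
  simp only [eq_comm]

/-- `ω_I = ∑_{i ∈ I} ω_i`. -/
def omega [IsSimplyConnected P] (I : Finset b.support) : L := ∑ i ∈ I, fundWeight b i

/-- `ρ`, the sum of the fundamental weights. -/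
def rho [IsSimplyConnected P] : L := omega b Finset.univ

/-- A weight is dominant if it is nonnegative on the simple coroots. -/
def Dominant (x : L) : Prop := ∀ i : b.support, 0 ≤ P.toLinearMap x (P.coroot i)

/-- The dominance order on `ℝ ⊗ X^*(T)`: `x ≤ y` if `y - x` is a nonnegative real linear combination
of simple roots. -/
def DomLE (x y : ℝ ⊗[ℤ] L) : Prop :=
  ∃ c : b.support → ℝ, (∀ i, 0 ≤ c i) ∧ y - x = ∑ i, c i • ((1 : ℝ) ⊗ₜ[ℤ] P.root i)

variable (P) in
/-- A positive definite symmetric bilinear form on `ℝ ⊗ X^*(T)` invariant under the Weyl group. -/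
structure IsInvariantInner (B : LinearMap.BilinForm ℝ (ℝ ⊗[ℤ] L)) : Prop where
  symm : ∀ x y, B x y = B y x
  pos : ∀ x, x ≠ 0 → 0 < B x x
  invariant : ∀ (w : P.weylGroup) (x y : L),
    B (1 ⊗ₜ (w • x)) (1 ⊗ₜ (w • y)) = B (1 ⊗ₜ x) (1 ⊗ₜ y)

/-- `h(w) = (ρ, ω_{I(w)})`. -/
def height [IsSimplyConnected P] (B : LinearMap.BilinForm ℝ (ℝ ⊗[ℤ] L)) (w : P.weylGroup) : ℝ :=
  B (1 ⊗ₜ rho b) (1 ⊗ₜ omega b (rightDescent b w))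

/-! ### The algebra `ℂ[T]`, the pairing and the Kazhdan-Lusztig-Steinberg basis -/

variable (L) in
/-- `N = ℂ[T]`, the group algebra of the character lattice. -/
abbrev CT := AddMonoidAlgebra ℂ L

/-- `exp(x) ∈ ℂ[T]` for a weight `x`. -/
def ex (x : L) : CT L := AddMonoidAlgebra.single x 1

/-- The action of the Weyl group on `ℂ[T]`, with `w exp(x) = exp(w x)`. -/
def act (w : P.weylGroup) (f : CT L) : CT L := AddMonoidAlgebra.mapDomain (fun x => w • x) f

/-- `[q]^* : ℂ[T] → ℂ[T]`, with `[q]^* exp(x) = exp(q x)`. -/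
def frob (q : ℕ) (f : CT L) : CT L := AddMonoidAlgebra.mapDomain (fun x => q • x) f

/-- `∑_w sgn(w) w(f)`. -/
def antisym [Finite ι] [IsSimplyConnected P] (f : CT L) : CT L :=
  ∑ w : P.weylGroup, sgn b w • act w f

/-- The Weyl denominator `δ = ∑_w sgn(w) exp(w ρ)`. -/
def denom [Finite ι] [IsSimplyConnected P] : CT L := antisym b (ex (rho b))

/-- The pairing `⟨f, g⟩ = δ⁻¹ ∑_w sgn(w) w(f g)`, with the quotient formed in the fraction field
of `ℂ[T]`. -/
def pairing [Finite ι] [IsSimplyConnected P] [Module.Free ℤ L] (f g : CT L) :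
    FractionRing (CT L) :=
  algebraMap (CT L) (FractionRing (CT L)) (antisym b (f * g)) /
    algebraMap (CT L) (FractionRing (CT L)) (denom b)

/-- The Weyl character `ch(V_x)`, given by the Weyl character formula. -/
def weylChar [Finite ι] [IsSimplyConnected P] [Module.Free ℤ L] (x : L) : FractionRing (CT L) :=
  algebraMap (CT L) (FractionRing (CT L)) (antisym b (ex (x + rho b))) /
    algebraMap (CT L) (FractionRing (CT L)) (denom b)

/-- The action on `ℂ[T]` of the element `C'_w = ∑_y P_{y,w}(1) y` of the Kazhdan-Lusztig basis of
`ℤ[W]`. -/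
def klAct [Finite ι] [IsSimplyConnected P] (w : P.weylGroup) (f : CT L) : CT L :=
  ∑ y : P.weylGroup, (klP b y w).eval 1 • act y f

/-- `f_w = |W_{I(w)}|⁻¹ C'_w exp(ω_J)`, where `J` is the complement of `I(w)`. -/
def fKLS [Finite ι] [IsSimplyConnected P] (w : P.weylGroup) : CT L :=
  open Classical in
  (Nat.card (parabolic b (rightDescent b w)) : ℂ)⁻¹ • klAct b w (ex (omega b (rightDescent b w)ᶜ))

/-- `g` is the basis dual to `(f_w)` under the pairing. -/
def IsDualKLS [Finite ι] [IsSimplyConnected P] [Module.Free ℤ L] (g : P.weylGroup → CT L) : Prop :=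
  open Classical in
  ∀ v w, pairing b (fKLS b v) (g w) = if v = w then 1 else 0

/-- `M_w = ⟨[q]^* f_{w₀ d}, f^*_{w₀ w}⟩`, where `(f^*_w)` is the dual basis and `d` is the Duflo
involution of the left cell of `w`. -/
def elemM [Finite ι] [IsSimplyConnected P] [Module.Free ℤ L] (fstar : P.weylGroup → CT L) (q : ℕ)
    (d w : P.weylGroup) : FractionRing (CT L) :=
  pairing b (frob q (fKLS b (longest b * d))) (fstar (longest b * w))

/-- `M` is a finite integer combination of Weyl characters `ch(V_x)`, with `x` dominant, such that
`x - ν` is in the Weyl group orbit of a dominant weight `y` with `0 ≤ y ≤ c ρ`. -/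
def IsCloseCombination [Finite ι] [IsSimplyConnected P] [Module.Free ℤ L]
    (M : FractionRing (CT L)) (ν : L) (c : ℝ) : Prop :=
  ∃ r : L →₀ ℤ,
    (∀ x ∈ r.support, Dominant b x ∧ ∃ y : L, Dominant b y ∧
      DomLE b 0 (1 ⊗ₜ y) ∧ DomLE b (1 ⊗ₜ y) (c • (1 ⊗ₜ rho b)) ∧
      ∃ w : P.weylGroup, x - ν = w • y) ∧
    M = r.sum fun x n => n • weylChar b x

end Coxeter

end

end KLS

set_option linter.unusedSectionVars false
set_option linter.style.haveILetI false

namespace KLS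

noncomputable section

variable {ι L L' : Type*} [AddCommGroup L] [AddCommGroup L'] {P : RootDatum ι L L'} (b : P.Base)

/-! ### Combinatorics of the Weyl group -/

/-! The theorem is a statement about supports. Let the hull of y be the set of weights all of whose
Weyl conjugates are at most y in the order defined by nonnegative rational combinations of simple
roots. Since P_{y,v}(1) and y ω depend only on y W_{I(v)} when ω is the fundamental sum over the
complement of I(v), f_v is an integer combination of exponentials on the W-orbit of that ω
(`fKLS_eq`). The dual element f*_w turns out to be an integer combination of exponentials in the
hull of ω_{I(w)} (`IsDualKLS.mem_hullSpan`).

Let d be the Duflo involution of the left cell of u, and I = I(u), J its complement. Right descent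
sets are constant on left cells (`SameLeftCell.rightDescent_eq`) and multiplication by w₀
complements them. So M_u is an integer combination of terms δ⁻¹ antisym(exp(q y ω_I + z)) with z in
the hull of ω_J. Each term is 0 or ± ch(V_{τ-ρ}), where τ is the dominant conjugate of the exponent.
Replacing the conjugate of q ω_I by q ω_I itself keeps the difference from τ in the hull
(`sub_mem_hull_of_sub_smul_mem`). Hence τ - ρ - (q-1)ω_I = (τ - q ω_I) - ω_J lies in the hull of 2ρ.
Both constants of the theorem are at least 2, because ρ pairs nonnegatively with dominant weights.

The dual basis comes from triangularity. The alternating sum of an element supported on the hull of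
y + ρ is δ times an invariant supported on the hull of y (`antisym_mem`). So f_v paired with exp(w
ω_{I(w)}) vanishes unless ω_{I(w)} - ω_{I(v)} ≥ 0. When I(v) = I(w), a nonzero term forces its
exponent to be conjugate to ρ; then P_{u,v} ≠ 0 for some u in w W_J, and minimality of w in this
coset leaves only v = w or ℓ(w) < ℓ(v). Gram elimination with invariant coefficients gives existence
(`exists_dual`), and a determinant gives uniqueness.

The Kazhdan-Lusztig input must be derived from the recursive definitions: the R-polynomials do not
depend on the descent chosen (`rWord_eq_of_wordProd_eq`), the recursively defined polynomials
satisfy the usual characterization (`isKL_klP_and`), and hence P_{xs,w} = P_{x,w} for a right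
descent s of w. The inversion symmetry then gives the left version. -/

theorem root_smul (w : P.weylGroup) (k : ι) : P.root (w • k) = w • P.root k :=
  RootPairing.Equiv.root_indexEquiv_eq_smul P k (w : P.Aut)

theorem simpleRefl_smul (i : b.support) (x : L) :
    simpleRefl b i • x = x - P.toLinearMap x (P.coroot i) • P.root i :=
  RootPairing.reflection_apply P i x

theorem simpleRefl_smul_index (i : b.support) (k : ι) :
    simpleRefl b i • k = P.reflectionPerm i k := rfl

theorem weyl_ext {w v : P.weylGroup} (h : ∀ x : L, w • x = v • x) : w = v := by
  apply Subtype.ext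
  apply RootPairing.Equiv.weightHom_injective P
  ext x
  exact h x

@[simp]
theorem simpleRefl_mul_self (i : b.support) : simpleRefl b i * simpleRefl b i = 1 := by
  apply weyl_ext
  intro x
  rw [mul_smul, one_smul]
  exact Module.involutive_reflection (P.flip.root_coroot_two i) x

@[simp]
theorem simpleRefl_inv (i : b.support) : (simpleRefl b i)⁻¹ = simpleRefl b i :=
  inv_eq_of_mul_eq_one_left (simpleRefl_mul_self b i)

@[simp]
theorem mul_simpleRefl_cancel (w : P.weylGroup) (i : b.support) :
    w * simpleRefl b i * simpleRefl b i = w := by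
  rw [mul_assoc, simpleRefl_mul_self, mul_one]

@[simp]
theorem simpleRefl_mul_cancel (w : P.weylGroup) (i : b.support) :
    simpleRefl b i * (simpleRefl b i * w) = w := by
  rw [← mul_assoc, simpleRefl_mul_self, one_mul]

/-- The product of a word in the simple reflections. -/
def wordProd (l : List b.support) : P.weylGroup := (l.map (simpleRefl b)).prod

@[simp] theorem wordProd_nil : wordProd b [] = 1 := rfl

@[simp] theorem wordProd_cons (i : b.support) (l : List b.support) :
    wordProd b (i :: l) = simpleRefl b i * wordProd b l := by
  simp [wordProd]

@[simp] theorem wordProd_append (l m : List b.support) :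
    wordProd b (l ++ m) = wordProd b l * wordProd b m := by
  simp [wordProd]

theorem wordProd_reverse (l : List b.support) : wordProd b l.reverse = (wordProd b l)⁻¹ := by
  induction l with
  | nil => simp
  | cons i l ih => simp [ih]

/-- The Weyl group preserves the pairing of weights with coroots. -/
theorem toLinearMap_smul_coroot_smul (w : P.weylGroup) (x : L) (k : ι) :
    P.toLinearMap (w • x) (P.coroot (w • k)) = P.toLinearMap x (P.coroot k) := by
  have h := congrFun (w : P.Aut).coroot_coweightMap (w • k)
  have h2 : (w : P.Aut).indexEquiv.symm (w • k) = k :=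
    (w : P.Aut).indexEquiv.symm_apply_apply k
  have h3 := (w : P.Aut).weight_coweight_transpose
  have h4 := LinearMap.congr_fun (LinearMap.congr_fun h3 (P.coroot (w • k))) x
  simp only [Function.comp_apply, h2] at h
  simp only [LinearMap.coe_comp, Function.comp_apply, h] at h4
  exact h4

theorem toLinearMap_smul_coroot (w : P.weylGroup) (x : L) (k : ι) :
    P.toLinearMap (w • x) (P.coroot k) = P.toLinearMap x (P.coroot (w⁻¹ • k)) := by
  rw [← toLinearMap_smul_coroot_smul w x (w⁻¹ • k), smul_inv_smul]

theorem ofIdx_smul_conj (w : P.weylGroup) (k : ι) :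
    RootPairing.weylGroup.ofIdx P (w • k) = w * RootPairing.weylGroup.ofIdx P k * w⁻¹ := by
  rw [eq_mul_inv_iff_mul_eq]
  apply weyl_ext
  intro x
  rw [mul_smul, mul_smul]
  change P.reflection (w • k) (w • x) = w • P.reflection k x
  rw [P.reflection_apply, P.reflection_apply, smul_sub, root_smul]
  congr 1
  rw [smul_comm w]
  congr 1
  exact toLinearMap_smul_coroot_smul w x k

section Finite

variable [Finite ι] [P.IsReduced]

/-- The Weyl group is generated by the reflections in all roots. Every root is reached from a simple
one by simple reflections, which conjugates the reflection, and hence a word for it. -/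
theorem exists_word (w : P.weylGroup) : ∃ l : List b.support, wordProd b l = w := by
  obtain ⟨g, hg⟩ := w
  induction hg using RootPairing.weylGroup.induction with
  | one => exact ⟨[], rfl⟩
  | mul x y hx hy h₁ h₂ =>
    obtain ⟨l, hl⟩ := h₁
    obtain ⟨m, hm⟩ := h₂
    exact ⟨l ++ m, by rw [wordProd_append, hl, hm]; rfl⟩
  | mem i =>
    change ∃ l, wordProd b l = RootPairing.weylGroup.ofIdx P i
    have key : ∀ (j k : ι), k ∈ b.support →
        (∃ l, wordProd b l = RootPairing.weylGroup.ofIdx P j) →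
        ∃ l, wordProd b l = RootPairing.weylGroup.ofIdx P (P.reflectionPerm k j) := by
      rintro j k hk ⟨l, hl⟩
      refine ⟨⟨k, hk⟩ :: l ++ [⟨k, hk⟩], ?_⟩
      have := ofIdx_smul_conj (simpleRefl b ⟨k, hk⟩) j
      rw [simpleRefl_inv, simpleRefl_smul_index] at this
      rw [this, wordProd_append, wordProd_cons, hl]
      simp
    refine RootPairing.Base.induction_reflect (b := b) i
      (p := fun j => ∃ l, wordProd b l = RootPairing.weylGroup.ofIdx P j) ?_ ?_ ?_
    · rintro j ⟨l, hl⟩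
      refine ⟨l, hl.trans ?_⟩
      have := ofIdx_smul_conj (RootPairing.weylGroup.ofIdx P j) j
      rw [mul_assoc, mul_inv_cancel, mul_one] at this
      exact this.symm
    · intro j hj
      exact ⟨[⟨j, hj⟩], by simp [wordProd, simpleRefl]⟩
    · intro j k h hk
      exact key j k hk h

/-! ### Length, positivity of roots and the sign character -/

theorem exists_reduced_word (w : P.weylGroup) :
    ∃ l : List b.support, l.length = len b w ∧ wordProd b l = w := by
  obtain ⟨l, hl⟩ := exists_word b w
  exact Nat.sInf_mem (s := {n | ∃ l : List b.support, l.length = n ∧ wordProd b l = w})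
    ⟨_, l, rfl, hl⟩

theorem len_wordProd_le (l : List b.support) : len b (wordProd b l) ≤ l.length :=
  Nat.sInf_le ⟨l, rfl, rfl⟩

@[simp]
theorem len_one : len b (1 : P.weylGroup) = 0 :=
  Nat.le_zero.mp (len_wordProd_le b [])

theorem eq_one_of_len_eq_zero {w : P.weylGroup} (h : len b w = 0) : w = 1 := by
  obtain ⟨l, hl, rfl⟩ := exists_reduced_word b w
  rw [h, List.length_eq_zero_iff] at hl
  rw [hl, wordProd_nil]

theorem len_mul_simpleRefl_le (w : P.weylGroup) (i : b.support) :
    len b (w * simpleRefl b i) ≤ len b w + 1 := by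
  obtain ⟨l, hl, rfl⟩ := exists_reduced_word b w
  simpa [hl] using len_wordProd_le b (l ++ [i])

theorem len_le_mul_simpleRefl (w : P.weylGroup) (i : b.support) :
    len b w ≤ len b (w * simpleRefl b i) + 1 := by
  simpa using len_mul_simpleRefl_le b (w * simpleRefl b i) i

theorem len_inv (w : P.weylGroup) : len b w⁻¹ = len b w := by
  have key : ∀ w : P.weylGroup, len b w⁻¹ ≤ len b w := by
    intro w
    obtain ⟨l, hl, rfl⟩ := exists_reduced_word b w
    rw [← wordProd_reverse]
    exact (len_wordProd_le b _).trans (by simp [hl])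
  exact le_antisymm (key w) (by simpa using key w⁻¹)

theorem isPos_simple (i : b.support) : b.IsPos (i : ι) :=
  RootPairing.Base.isPos_of_mem_support i.2

theorem isPos_of_root_eq_neg {j k : ι} (h : P.root j = -P.root k) : b.IsPos j ↔ ¬ b.IsPos k := by
  letI := P.indexNeg
  have : j = -k := by
    apply P.root.injective
    simpa using h
  rw [this]
  exact RootPairing.Base.IsPos.neg_iff_not b k

theorem isPos_smul_refl_self (w : P.weylGroup) (i : b.support) :
    b.IsPos ((w * simpleRefl b i) • (i : ι)) ↔ ¬ b.IsPos (w • (i : ι)) := by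
  apply isPos_of_root_eq_neg
  rw [root_smul, root_smul, mul_smul, simpleRefl_smul, P.root_coroot_two]
  rw [two_smul, ← smul_neg]
  congr 1
  abel

theorem isPos_simpleRefl_smul_iff (i : b.support) {k : ι} (h₁ : k ≠ i)
    (h₂ : P.root k ≠ -P.root i) : b.IsPos (simpleRefl b i • k) ↔ b.IsPos k := by
  constructor
  · intro h
    have h' : P.reflectionPerm i (simpleRefl b i • k) = k := P.reflectionPerm_self i k
    rw [← h']
    refine h.reflectionPerm i.2 fun h3 => h₂ ?_
    have h4 : k = P.reflectionPerm i i := by rw [h3] at h'; exact h'.symm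
    rw [h4]; simp
  · intro h
    exact h.reflectionPerm i.2 h₁

/-- A simple reflection makes a root change sign only if the root is a simple one, up to sign. -/
theorem eq_of_isPos_of_not_isPos (i : b.support) {k : ι} (h₁ : b.IsPos k)
    (h₂ : ¬ b.IsPos (simpleRefl b i • k)) : k = i := by
  by_contra h
  refine h₂ ((isPos_simpleRefl_smul_iff b i h fun h3 => ?_).mpr h₁)
  exact (isPos_of_root_eq_neg b h3).mp h₁ (isPos_simple b i)

/-- The exchange property of words. -/
theorem exists_wordProd_mul_simpleRefl (i : b.support) (l : List b.support)
    (h : ¬ b.IsPos (wordProd b l • (i : ι))) :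
    ∃ m : List b.support, m.length + 1 = l.length ∧ wordProd b m = wordProd b l * simpleRefl b i := by
  induction l with
  | nil => exact absurd (by simpa using isPos_simple b i) h
  | cons j l ih =>
    -- Letters act from the right end of the word. At the letter j where the image of α_i first
    -- turns negative, that image was α_j, so s_j u = u s_i for the remaining product u, and the
    -- letter can be deleted.
    by_cases h' : b.IsPos (wordProd b l • (i : ι))
    · rw [wordProd_cons, mul_smul] at h
      have := eq_of_isPos_of_not_isPos b j h' h
      refine ⟨l, rfl, ?_⟩
      have h3 := ofIdx_smul_conj (wordProd b l) (i : ι)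
      rw [this, eq_mul_inv_iff_mul_eq] at h3
      change simpleRefl b j * wordProd b l = wordProd b l * simpleRefl b i at h3
      rw [wordProd_cons, h3, mul_simpleRefl_cancel]
    · obtain ⟨m, hm, hm'⟩ := ih h'
      exact ⟨j :: m, by simp [hm], by simp [hm', mul_assoc]⟩

theorem len_mul_simpleRefl_of_not_isPos {w : P.weylGroup} {i : b.support}
    (h : ¬ b.IsPos (w • (i : ι))) : len b (w * simpleRefl b i) + 1 = len b w := by
  refine le_antisymm ?_ (len_le_mul_simpleRefl b w i)
  obtain ⟨l, hl, rfl⟩ := exists_reduced_word b w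
  obtain ⟨m, hm, hm'⟩ := exists_wordProd_mul_simpleRefl b i l h
  rw [← hm', ← hl, ← hm]
  exact Nat.succ_le_succ (len_wordProd_le b m)

theorem len_mul_simpleRefl_of_isPos {w : P.weylGroup} {i : b.support}
    (h : b.IsPos (w • (i : ι))) : len b (w * simpleRefl b i) = len b w + 1 := by
  have := len_mul_simpleRefl_of_not_isPos b (w := w * simpleRefl b i) (i := i)
    (by rw [isPos_smul_refl_self]; exact not_not.mpr h)
  rw [mul_simpleRefl_cancel] at this
  exact this.symm

theorem len_mul_lt_iff (w : P.weylGroup) (i : b.support) :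
    len b (w * simpleRefl b i) < len b w ↔ ¬ b.IsPos (w • (i : ι)) := by
  by_cases h : b.IsPos (w • (i : ι))
  · have := len_mul_simpleRefl_of_isPos b h
    simp only [h, not_true, iff_false]; omega
  · have := len_mul_simpleRefl_of_not_isPos b h
    simp only [h, not_false_iff, iff_true]; omega

theorem len_mul_eq_or (w : P.weylGroup) (i : b.support) :
    len b (w * simpleRefl b i) = len b w + 1 ∨ len b (w * simpleRefl b i) + 1 = len b w := by
  by_cases h : b.IsPos (w • (i : ι))
  · exact Or.inl (len_mul_simpleRefl_of_isPos b h)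
  · exact Or.inr (len_mul_simpleRefl_of_not_isPos b h)

theorem len_simpleRefl_mul (w : P.weylGroup) (i : b.support) :
    len b (simpleRefl b i * w) = len b (w⁻¹ * simpleRefl b i) := by
  rw [← len_inv]; simp

theorem len_simpleRefl_mul_eq_or (w : P.weylGroup) (i : b.support) :
    len b (simpleRefl b i * w) = len b w + 1 ∨ len b (simpleRefl b i * w) + 1 = len b w := by
  rw [len_simpleRefl_mul, ← len_inv b w]
  exact len_mul_eq_or b w⁻¹ i

theorem exists_descent {w : P.weylGroup} (h : w ≠ 1) :
    ∃ i, len b (w * simpleRefl b i) < len b w := by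
  obtain ⟨l, hl, rfl⟩ := exists_reduced_word b w
  induction l using List.reverseRecOn with
  | nil => exact absurd rfl h
  | append_singleton l i _ =>
    refine ⟨i, ?_⟩
    rw [← hl, wordProd_append, wordProd_cons, wordProd_nil, mul_one, mul_simpleRefl_cancel]
    exact (len_wordProd_le b l).trans_lt (by simp)

theorem exists_left_descent {w : P.weylGroup} (h : w ≠ 1) :
    ∃ i, len b (simpleRefl b i * w) < len b w := by
  obtain ⟨i, hi⟩ := exists_descent b (w := w⁻¹) (by simpa using h)
  exact ⟨i, by rwa [len_simpleRefl_mul, ← len_inv b w]⟩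

/-- The length conditions say that w α_j is positive while s_i w α_j is negative, so w α_j = α_i. -/
theorem simpleRefl_mul_eq_mul_simpleRefl {w : P.weylGroup} {i j : b.support}
    (h : len b w < len b (w * simpleRefl b j))
    (h' : len b (simpleRefl b i * w * simpleRefl b j) < len b (simpleRefl b i * w)) :
    simpleRefl b i * w = w * simpleRefl b j := by
  rw [len_mul_lt_iff, mul_smul] at h'
  have h1 : b.IsPos (w • (j : ι)) := by
    by_contra h2
    have := (len_mul_lt_iff b w j).mpr h2
    omega
  have h3 := ofIdx_smul_conj w (j : ι)
  rw [eq_of_isPos_of_not_isPos b i h1 h', eq_mul_inv_iff_mul_eq] at h3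
  exact h3

theorem sgn_mul_simpleRefl (w : P.weylGroup) (i : b.support) :
    sgn b (w * simpleRefl b i) = -sgn b w := by
  unfold sgn
  rcases len_mul_eq_or b w i with h | h
  · rw [h, pow_succ]; ring
  · rw [← h, pow_succ]; ring

@[simp] theorem sgn_one : sgn b (1 : P.weylGroup) = 1 := by simp [sgn]

theorem sgn_mul (w v : P.weylGroup) : sgn b (w * v) = sgn b w * sgn b v := by
  obtain ⟨l, rfl⟩ := exists_word b v
  induction l using List.reverseRecOn with
  | nil => simp
  | append_singleton l i ih =>
    rw [wordProd_append, wordProd_cons, wordProd_nil, mul_one, ← mul_assoc, sgn_mul_simpleRefl, ih,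
      sgn_mul_simpleRefl, mul_neg]

theorem sgn_mul_self (w : P.weylGroup) : sgn b w * sgn b w = 1 := by
  rw [sgn, ← mul_pow]; simp

theorem sgn_simpleRefl (i : b.support) : sgn b (simpleRefl b i) = -1 := by
  simpa using sgn_mul_simpleRefl b 1 i

/-- An element that keeps all simple roots positive is trivial. -/
theorem eq_one_of_forall_isPos {w : P.weylGroup} (h : ∀ i : b.support, b.IsPos (w • (i : ι))) :
    w = 1 := by
  by_contra h'
  obtain ⟨i, hi⟩ := exists_descent b h'
  exact (len_mul_lt_iff b w i).mp hi (h i)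

theorem isPos_iff_mem_closure (k : ι) :
    b.IsPos k ↔ P.root k ∈ AddSubmonoid.closure (P.root '' b.support) := by
  classical
  constructor
  · intro h
    refine h.induction_on_add (p := fun k => P.root k ∈ AddSubmonoid.closure (P.root '' b.support))
      (fun i hi => AddSubmonoid.subset_closure ⟨i, hi, rfl⟩)
      fun i j k hk h hj => ?_
    rw [hk]
    exact add_mem h (AddSubmonoid.subset_closure ⟨j, hj, rfl⟩)
  · intro h
    rw [← Submodule.span_nat_eq_addSubmonoidClosure, Submodule.mem_toAddSubmonoid,
      Set.image_eq_range, Submodule.mem_span_range_iff_exists_fun] at h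
    obtain ⟨c, hc⟩ := h
    have : P.root k = ∑ j ∈ b.support, (fun j => if h : j ∈ b.support then (c ⟨j, h⟩ : ℤ) else 0) j •
        P.root j := by
      rw [← hc, ← Finset.sum_coe_sort b.support]
      refine Finset.sum_congr rfl fun i _ => ?_
      simp
    rw [RootPairing.Base.isPos_iff', RootPairing.Base.height_eq_sum this]
    refine Finset.sum_nonneg fun j hj => ?_
    simp [hj]

/-! ### The longest element -/

section Longest

variable [IsSimplyConnected P]

theorem len_le_longest (w : P.weylGroup) : len b w ≤ len b (longest b) :=
  (exists_longest b).choose_spec w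

theorem not_isPos_longest_smul_simple (i : b.support) : ¬ b.IsPos (longest b • (i : ι)) := by
  intro h
  have := len_mul_simpleRefl_of_isPos b h
  have := len_le_longest b (longest b * simpleRefl b i)
  omega

theorem not_isPos_longest_smul {k : ι} (hk : b.IsPos k) : ¬ b.IsPos (longest b • k) := by
  intro h
  have hs : ∀ i ∈ b.support, -(longest b • P.root i) ∈ AddSubmonoid.closure (P.root '' b.support) := by
    intro i hi
    rw [← root_smul]
    refine (b.root_mem_or_neg_mem (longest b • i)).resolve_left ?_
    rw [← isPos_iff_mem_closure]
    exact not_isPos_longest_smul_simple b ⟨i, hi⟩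
  have key : ∀ k, b.IsPos k → -(longest b • P.root k) ∈ AddSubmonoid.closure (P.root '' b.support) := by
    intro k hk
    refine hk.induction_on_add
      (p := fun k => -(longest b • P.root k) ∈ AddSubmonoid.closure (P.root '' b.support)) hs fun i j k hk h hj => ?_
    rw [hk, smul_add, neg_add]
    exact add_mem h (hs j hj)
  letI := P.indexNeg
  have h1 := key k hk
  rw [← root_smul] at h1
  have h2 : b.IsPos (-(longest b • k)) := by
    rw [isPos_iff_mem_closure]
    simpa using h1
  rw [RootPairing.Base.IsPos.neg_iff_not] at h2
  exact h2 h

theorem isPos_longest_smul_iff (k : ι) : b.IsPos (longest b • k) ↔ ¬ b.IsPos k := by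
  refine ⟨fun h hk => not_isPos_longest_smul b hk h, fun hk => ?_⟩
  letI := P.indexNeg
  have h1 : b.IsPos (-k) := (RootPairing.Base.IsPos.neg_iff_not b k).mpr hk
  have h2 := not_isPos_longest_smul b h1
  rw [isPos_of_root_eq_neg b (k := longest b • k), not_not] at h2
  · exact h2
  · rw [root_smul, root_smul]; simp

/-- `longest` is merely some element of maximal length. Maximality makes it exchange positive and
negative roots, so its square keeps every simple root positive. -/
theorem longest_mul_self : longest b * longest b = 1 := by
  apply eq_one_of_forall_isPos b
  intro i
  rw [mul_smul, isPos_longest_smul_iff, isPos_longest_smul_iff, not_not]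
  exact isPos_simple b i

theorem mem_rightDescent {w : P.weylGroup} {i : b.support} :
    i ∈ rightDescent b w ↔ ¬ b.IsPos (w • (i : ι)) := by
  rw [rightDescent, Finset.mem_filter, len_mul_lt_iff]
  simp

open Classical in
theorem rightDescent_longest_mul (w : P.weylGroup) :
    rightDescent b (longest b * w) = (rightDescent b w)ᶜ := by
  ext i
  rw [Finset.mem_compl, mem_rightDescent, mem_rightDescent, mul_smul, isPos_longest_smul_iff]

end Longest

end Finite

end

end KLS

namespace KLS

noncomputable section

variable {ι L L' : Type*} [AddCommGroup L] [AddCommGroup L'] {P : RootDatum ι L L'} (b : P.Base)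

/-! ### Well-definedness of the `R`-polynomials -/

section RPolynomials

open Polynomial

variable [Finite ι] [P.IsReduced]

theorem exists_reduced_word_append {w : P.weylGroup} {i : b.support}
    (h : len b (w * simpleRefl b i) < len b w) : ∃ l : List b.support,
      l.length = len b (w * simpleRefl b i) ∧ wordProd b l = w * simpleRefl b i ∧
        (l ++ [i]).length = len b w ∧ wordProd b (l ++ [i]) = w := by
  obtain ⟨l, hl, hl'⟩ := exists_reduced_word b (w * simpleRefl b i)
  refine ⟨l, hl, hl', ?_, by simp [hl']⟩
  rw [List.length_append, hl, List.length_singleton]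
  rcases len_mul_eq_or b w i with h' | h' <;> omega

/-- Right multiplication by `T_i`, up to a change of signs and of generator. -/
def rOp (i : b.support) : (P.weylGroup → ℤ[X]) →ₗ[ℤ[X]] (P.weylGroup → ℤ[X]) where
  toFun m z := if len b (z * simpleRefl b i) < len b z then m (z * simpleRefl b i) else
    X * m (z * simpleRefl b i) + (X - 1) * m z
  map_add' m n := by ext1 z; simp only [Pi.add_apply]; split_ifs <;> ring
  map_smul' c m := by
    ext1 z; simp only [Pi.smul_apply, smul_eq_mul, RingHom.id_apply]; split_ifs <;> ring

/-- Left multiplication by `T_i`, up to a change of signs and of generator. -/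
def lOp (i : b.support) : (P.weylGroup → ℤ[X]) →ₗ[ℤ[X]] (P.weylGroup → ℤ[X]) where
  toFun m z := if len b (simpleRefl b i * z) < len b z then m (simpleRefl b i * z) else
    X * m (simpleRefl b i * z) + (X - 1) * m z
  map_add' m n := by ext1 z; simp only [Pi.add_apply]; split_ifs <;> ring
  map_smul' c m := by
    ext1 z; simp only [Pi.smul_apply, smul_eq_mul, RingHom.id_apply]; split_ifs <;> ring

theorem rOp_apply (i : b.support) (m : P.weylGroup → ℤ[X]) (z : P.weylGroup) :
    rOp b i m z = if len b (z * simpleRefl b i) < len b z then m (z * simpleRefl b i) else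
      X * m (z * simpleRefl b i) + (X - 1) * m z := rfl

theorem lOp_apply (i : b.support) (m : P.weylGroup → ℤ[X]) (z : P.weylGroup) :
    lOp b i m z = if len b (simpleRefl b i * z) < len b z then m (simpleRefl b i * z) else
      X * m (simpleRefl b i * z) + (X - 1) * m z := rfl

/-- If s_i z = z s_j, then s_i z s_j = z and both sides agree by substitution. Otherwise left and
right multiplication change the length independently, by `simpleRefl_mul_eq_mul_simpleRefl`, and
each pattern of lengths is a direct check. -/
theorem lOp_rOp (i j : b.support) (m : P.weylGroup → ℤ[X]) :
    lOp b i (rOp b j m) = rOp b j (lOp b i m) := by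
  ext1 z
  simp only [lOp_apply, rOp_apply, mul_assoc]
  have h1 := len_mul_eq_or b z j
  have h2 := len_simpleRefl_mul_eq_or b z i
  have h3 := len_mul_eq_or b (simpleRefl b i * z) j
  have h4 := len_simpleRefl_mul_eq_or b (z * simpleRefl b j) i
  have h5 := simpleRefl_mul_eq_mul_simpleRefl b (w := z) (i := i) (j := j)
  have h6 := simpleRefl_mul_eq_mul_simpleRefl b (w := z * simpleRefl b j) (i := i) (j := j)
  simp only [mul_assoc, simpleRefl_mul_self, mul_one] at h3 h5 h6
  by_cases h7 : simpleRefl b i * z = z * simpleRefl b j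
  · have h8 : simpleRefl b i * (z * simpleRefl b j) = z := by
      rw [← mul_assoc, h7, mul_simpleRefl_cancel]
    rw [h7, h8] at *
  · have h9 : simpleRefl b i * (z * simpleRefl b j) ≠ z := by
      intro h; apply h7; rw [← mul_assoc] at h; rw [← h, mul_simpleRefl_cancel, h]
    by_cases a1 : len b (z * simpleRefl b j) < len b z
    · have a2 : len b (simpleRefl b i * (z * simpleRefl b j)) < len b (simpleRefl b i * z) := by
        by_contra h
        exact h9 (h6 a1 (by omega))
      by_cases a3 : len b (simpleRefl b i * z) < len b z
      · have a4 : len b (simpleRefl b i * (z * simpleRefl b j)) < len b (z * simpleRefl b j) := by omega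
        simp only [a1, a2, a3, a4, if_true]
      · have a4 : ¬ len b (simpleRefl b i * (z * simpleRefl b j)) < len b (z * simpleRefl b j) := by omega
        simp only [a1, a2, a3, a4, if_true, if_false]
    · have a2 : ¬ len b (simpleRefl b i * (z * simpleRefl b j)) < len b (simpleRefl b i * z) := by
        intro h
        exact h7 (h5 (by omega) h)
      by_cases a3 : len b (simpleRefl b i * z) < len b z
      · have a4 : len b (simpleRefl b i * (z * simpleRefl b j)) < len b (z * simpleRefl b j) := by omega
        simp only [a1, a2, a3, a4, if_true, if_false]
      · have a4 : ¬ len b (simpleRefl b i * (z * simpleRefl b j)) < len b (z * simpleRefl b j) := by omega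
        simp only [a1, a2, a3, a4, if_false]
        ring

/-- The composite of the operators `rOp` along a word. -/
def rWord : List b.support → (P.weylGroup → ℤ[X]) →ₗ[ℤ[X]] (P.weylGroup → ℤ[X])
  | [] => LinearMap.id
  | i :: l => rWord l ∘ₗ rOp b i

/-- The composite of the operators `lOp` along a word. -/
def lWord : List b.support → (P.weylGroup → ℤ[X]) →ₗ[ℤ[X]] (P.weylGroup → ℤ[X])
  | [] => LinearMap.id
  | i :: l => lOp b i ∘ₗ lWord l

theorem rWord_append (l : List b.support) (i : b.support) (m : P.weylGroup → ℤ[X]) :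
    rWord b (l ++ [i]) m = rOp b i (rWord b l m) := by
  induction l generalizing m with
  | nil => rfl
  | cons j l ih => exact ih _

theorem lOp_rWord (i : b.support) (l : List b.support) (m : P.weylGroup → ℤ[X]) :
    lOp b i (rWord b l m) = rWord b l (lOp b i m) := by
  induction l generalizing m with
  | nil => rfl
  | cons j l ih => exact (ih _).trans (by rw [lOp_rOp]; rfl)

theorem lWord_rWord (k l : List b.support) (m : P.weylGroup → ℤ[X]) :
    lWord b k (rWord b l m) = rWord b l (lWord b k m) := by
  induction k with
  | nil => rfl
  | cons i k ih =>
    change lOp b i (lWord b k (rWord b l m)) = rWord b l (lOp b i (lWord b k m))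
    rw [ih, lOp_rWord]

open Classical in
theorem rOp_single {i : b.support} {z : P.weylGroup} (h : len b (z * simpleRefl b i) < len b z) :
    rOp b i (Pi.single z 1) = (X : ℤ[X]) • Pi.single (z * simpleRefl b i) 1 := by
  ext1 y
  rw [rOp_apply, Pi.smul_apply, smul_eq_mul]
  by_cases h1 : y = z
  · subst h1
    have h2 : y * simpleRefl b i ≠ y := fun h2 => by rw [h2] at h; exact lt_irrefl _ h
    rw [if_pos h, Pi.single_eq_of_ne h2, Pi.single_eq_of_ne h2.symm, mul_zero]
  · by_cases h2 : y = z * simpleRefl b i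
    · subst h2
      rw [mul_simpleRefl_cancel, if_neg (by omega), Pi.single_eq_same, Pi.single_eq_of_ne h1,
        Pi.single_eq_same]
      ring
    · have h3 : y * simpleRefl b i ≠ z := fun h3 => h2 (by rw [← h3, mul_simpleRefl_cancel])
      rw [Pi.single_eq_of_ne h1, Pi.single_eq_of_ne h2, Pi.single_eq_of_ne h3]
      simp

open Classical in
theorem lOp_single {i : b.support} {z : P.weylGroup} (h : len b (simpleRefl b i * z) < len b z) :
    lOp b i (Pi.single z 1) = (X : ℤ[X]) • Pi.single (simpleRefl b i * z) 1 := by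
  ext1 y
  rw [lOp_apply, Pi.smul_apply, smul_eq_mul]
  by_cases h1 : y = z
  · subst h1
    have h2 : simpleRefl b i * y ≠ y := fun h2 => by rw [h2] at h; exact lt_irrefl _ h
    rw [if_pos h, Pi.single_eq_of_ne h2, Pi.single_eq_of_ne h2.symm, mul_zero]
  · by_cases h2 : y = simpleRefl b i * z
    · subst h2
      rw [simpleRefl_mul_cancel, if_neg (by omega), Pi.single_eq_same, Pi.single_eq_of_ne h1,
        Pi.single_eq_same]
      ring
    · have h3 : simpleRefl b i * y ≠ z := fun h3 => h2 (by rw [← h3, simpleRefl_mul_cancel])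
      rw [Pi.single_eq_of_ne h1, Pi.single_eq_of_ne h2, Pi.single_eq_of_ne h3]
      simp

-- At the identity, left and right operators agree. With their commutation this later turns the
-- right recursion for `klR` into a left one.
open Classical in
theorem rOp_single_one (i : b.support) :
    rOp b i (Pi.single (1 : P.weylGroup) 1) = lOp b i (Pi.single (1 : P.weylGroup) 1) := by
  ext1 y
  rw [rOp_apply, lOp_apply]
  have hs : len b (1 * simpleRefl b i) = 1 := by
    have h2 := len_mul_simpleRefl_of_isPos b (w := 1) (i := i) (by simpa using isPos_simple b i)
    simpa using h2
  rw [one_mul] at hs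
  by_cases h1 : y = simpleRefl b i
  · subst h1
    simp [hs]
  · have h2 : y * simpleRefl b i ≠ 1 := fun h => h1 (by
      rw [eq_inv_of_mul_eq_one_left h, simpleRefl_inv])
    have h3 : simpleRefl b i * y ≠ 1 := fun h => h1 (by
      rw [eq_inv_of_mul_eq_one_right h, simpleRefl_inv])
    by_cases h4 : y = 1
    · subst h4; simp [hs]
    · rw [Pi.single_eq_of_ne h2, Pi.single_eq_of_ne h3, Pi.single_eq_of_ne h4]
      simp

/-! ### Independence of the recursion from the chosen descents -/

variable [IsSimplyConnected P]

theorem len_longest_mul (w : P.weylGroup) : len b (longest b * w) + len b w = len b (longest b) := by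
  generalize hn : len b w = n
  induction n generalizing w with
  | zero => rw [eq_one_of_len_eq_zero b hn, mul_one, add_zero]
  | succ n ih =>
    obtain ⟨i, hi⟩ := exists_descent b (w := w) (by rintro rfl; simp at hn)
    have h1 := len_mul_simpleRefl_of_not_isPos b ((len_mul_lt_iff b w i).mp hi)
    have h2 := ih (w * simpleRefl b i) (by omega)
    have h3 := len_mul_simpleRefl_of_isPos b (w := longest b * w) (i := i) (by
      rw [mul_smul, isPos_longest_smul_iff]; exact (len_mul_lt_iff b w i).mp hi)
    rw [mul_assoc] at h3
    omega

theorem longest_inv : (longest b)⁻¹ = longest b :=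
  inv_eq_of_mul_eq_one_left (longest_mul_self b)

theorem len_mul_longest (w : P.weylGroup) : len b (w * longest b) + len b w = len b (longest b) := by
  rw [← len_inv b (w * longest b), mul_inv_rev, longest_inv, ← len_inv b w, len_longest_mul]

-- Multiplication by w₀ reverses lengths, so along a reduced word every step starting at w₀ goes
-- down, where the operator moves a delta function at the cost of one factor X. The value visibly
-- depends only on the product of the word.
open Classical in
theorem rWord_single_longest (l : List b.support) (h : l.length = len b (wordProd b l)) :
    rWord b l (Pi.single (longest b) 1) =
      (X ^ l.length : ℤ[X]) • Pi.single (longest b * wordProd b l) 1 := by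
  induction l using List.reverseRecOn with
  | nil => simp [rWord]
  | append_singleton l i ih =>
    have h1 := len_wordProd_le b l
    have h2 := len_mul_simpleRefl_le b (wordProd b l) i
    have h3 := len_longest_mul b (wordProd b l)
    have h4 := len_longest_mul b (wordProd b l * simpleRefl b i)
    rw [← mul_assoc] at h4
    simp only [wordProd_append, wordProd_cons, wordProd_nil, mul_one, List.length_append,
      List.length_singleton] at h ⊢
    rw [rWord_append, ih (by omega), map_smul, rOp_single b (by omega), smul_smul, pow_succ,
      mul_assoc]

open Classical in
theorem lWord_single_longest (l : List b.support) (h : l.length = len b (wordProd b l)) :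
    lWord b l (Pi.single (longest b) 1) =
      (X ^ l.length : ℤ[X]) • Pi.single (wordProd b l * longest b) 1 := by
  induction l with
  | nil => simp [lWord]
  | cons i l ih =>
    have h1 := len_wordProd_le b l
    have h2 := len_simpleRefl_mul_eq_or b (wordProd b l) i
    have h3 := len_mul_longest b (wordProd b l)
    have h4 := len_mul_longest b (simpleRefl b i * wordProd b l)
    rw [mul_assoc] at h4
    simp only [wordProd_cons, List.length_cons] at h ⊢
    change lOp b i (lWord b l _) = _
    rw [ih (by omega), map_smul, lOp_single b (by omega), smul_smul, pow_succ, mul_assoc]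

/-- The operator attached to a reduced word depends only on the product of the word. -/
theorem rWord_eq_of_wordProd_eq {k l : List b.support} (h : wordProd b k = wordProd b l)
    (hk : k.length = len b (wordProd b k)) (hl : l.length = len b (wordProd b l)) :
    rWord b k = rWord b l := by
  classical
  refine LinearMap.pi_ext' fun z => LinearMap.ext_ring ?_
  change rWord b k (Pi.single z 1) = rWord b l (Pi.single z 1)
  -- Up to a power of X, the delta function at z comes from the one at w₀ by left operators. These
  -- commute with the right operators, so the comparison reduces to w₀, and the power of X is
  -- cancelled at the end.
  obtain ⟨u, hu, hu'⟩ := exists_reduced_word b (z * longest b)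
  have hz := lWord_single_longest b u (by rw [hu, hu'])
  rw [hu', mul_assoc, longest_mul_self, mul_one] at hz
  have h1 : (X ^ u.length : ℤ[X]) • rWord b k (Pi.single z 1) =
      (X ^ u.length : ℤ[X]) • rWord b l (Pi.single z 1) := by
    rw [← map_smul, ← map_smul, ← hz, ← lWord_rWord, ← lWord_rWord, rWord_single_longest b k hk,
      rWord_single_longest b l hl, hk, hl, h]
  exact smul_right_injective _ (pow_ne_zero _ X_ne_zero) h1

open Classical in
theorem klR_one : (fun x => klR b x 1) = Pi.single (1 : P.weylGroup) 1 := by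
  ext1 x
  rw [klR, dif_neg (by simp)]
  by_cases h : x = 1
  · simp [h]
  · rw [if_neg h, Pi.single_eq_of_ne h]

theorem exists_klR_eq {w : P.weylGroup} (h : w ≠ 1) :
    ∃ i, len b (w * simpleRefl b i) < len b w ∧
      (fun x => klR b x w) = rOp b i fun x => klR b x (w * simpleRefl b i) := by
  have h' := exists_descent b h
  refine ⟨h'.choose, h'.choose_spec, ?_⟩
  ext1 x
  rw [klR, dif_pos h', rOp_apply]

open Classical in
theorem klR_wordProd (l : List b.support) (h : l.length = len b (wordProd b l)) :
    (fun x => klR b x (wordProd b l)) = rWord b l (Pi.single 1 1) := by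
  generalize hn : l.length = n
  induction n generalizing l with
  | zero =>
    rw [List.length_eq_zero_iff] at hn
    rw [hn, wordProd_nil, klR_one]; rfl
  | succ n ih =>
    obtain ⟨i, hi, hi'⟩ := exists_klR_eq b (w := wordProd b l) (by
      intro h1; rw [h1, len_one] at h; omega)
    obtain ⟨k, hk, hk', hk1, hk2⟩ := exists_reduced_word_append b hi
    rw [List.length_append, List.length_singleton] at hk1
    rw [rWord_eq_of_wordProd_eq b hk2.symm h (by simp only [hk2]; simpa using hk1), rWord_append,
      ← ih k (by rw [hk', hk]) (by omega), hi', hk']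

theorem klR_mul_simpleRefl {w : P.weylGroup} {i : b.support}
    (h : len b (w * simpleRefl b i) < len b w) :
    (fun x => klR b x w) = rOp b i fun x => klR b x (w * simpleRefl b i) := by
  classical
  obtain ⟨k, hk, hk', hk1, hk2⟩ := exists_reduced_word_append b h
  have h1 := klR_wordProd b k (by rw [hk', hk])
  have h2 := klR_wordProd b (k ++ [i]) (by rw [hk2, hk1])
  rw [hk'] at h1
  rw [hk2, rWord_append, ← h1] at h2
  exact h2

/-- For w = s_i v with v shorter, the right operators along s_i followed by a word for v start with
`rOp b i` at the identity. This is replaced by `lOp b i`, which is then pulled out to the front. -/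
theorem klR_simpleRefl_mul {w : P.weylGroup} {i : b.support}
    (h : len b (simpleRefl b i * w) < len b w) :
    (fun x => klR b x w) = lOp b i fun x => klR b x (simpleRefl b i * w) := by
  classical
  obtain ⟨k, hk, hk'⟩ := exists_reduced_word b (simpleRefl b i * w)
  have h0 := len_simpleRefl_mul_eq_or b w i
  have h1 := klR_wordProd b k (by rw [hk', hk])
  have h3 : wordProd b (i :: k) = w := by simp [hk']
  have h2 := klR_wordProd b (i :: k) (by rw [h3, List.length_cons]; omega)
  rw [hk'] at h1
  rw [h3] at h2
  rw [h2, h1, lOp_rWord, ← rOp_single_one]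
  rfl

theorem klR_inv (x w : P.weylGroup) : klR b x⁻¹ w⁻¹ = klR b x w := by
  classical
  generalize hn : len b w = n
  induction n generalizing x w with
  | zero =>
    rw [eq_one_of_len_eq_zero b hn, inv_one]
    have h := klR_one b
    rw [congrFun h x, congrFun h x⁻¹]
    by_cases h1 : x = 1
    · rw [h1, inv_one]
    · rw [Pi.single_eq_of_ne h1, Pi.single_eq_of_ne (by simpa using h1)]
  | succ n ih =>
    obtain ⟨i, hi⟩ := exists_descent b (w := w) (by rintro rfl; simp at hn)
    have h1 : len b (simpleRefl b i * w⁻¹) < len b w⁻¹ := by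
      rw [len_simpleRefl_mul, inv_inv, len_inv]; exact hi
    have h2 : simpleRefl b i * w⁻¹ = (w * simpleRefl b i)⁻¹ := by simp
    have h3 : simpleRefl b i * x⁻¹ = (x * simpleRefl b i)⁻¹ := by simp
    have h4 := len_mul_eq_or b w i
    have h5 := congrFun (klR_mul_simpleRefl b hi) x
    have h6 := congrFun (klR_simpleRefl_mul b h1) x⁻¹
    simp only [lOp_apply, rOp_apply] at h5 h6
    rw [h5, h6, h2, h3, ih _ _ (by omega), ih _ _ (by omega), len_inv, len_inv]

theorem klR_self (w : P.weylGroup) : klR b w w = 1 := by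
  classical
  generalize hn : len b w = n
  induction n generalizing w with
  | zero =>
    rw [eq_one_of_len_eq_zero b hn, congrFun (klR_one b) 1, Pi.single_eq_same]
  | succ n ih =>
    obtain ⟨i, hi⟩ := exists_descent b (w := w) (by rintro rfl; simp at hn)
    have h4 := len_mul_eq_or b w i
    rw [congrFun (klR_mul_simpleRefl b hi) w, rOp_apply, if_pos hi, ih _ (by omega)]

theorem klR_eq_zero {x w : P.weylGroup} (h : x ≠ w) (h' : len b w ≤ len b x) :
    klR b x w = 0 := by
  classical
  generalize hn : len b w = n
  induction n generalizing x w with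
  | zero =>
    rw [eq_one_of_len_eq_zero b hn] at h ⊢
    rw [congrFun (klR_one b) x, Pi.single_eq_of_ne h]
  | succ n ih =>
    obtain ⟨i, hi⟩ := exists_descent b (w := w) (by rintro rfl; simp at hn)
    have h4 := len_mul_eq_or b w i
    have h5 := len_mul_eq_or b x i
    have h6 : x * simpleRefl b i ≠ w * simpleRefl b i := fun h7 => h (mul_right_cancel h7)
    rw [congrFun (klR_mul_simpleRefl b hi) x, rOp_apply, ih h6 (by omega) (by omega)]
    split_ifs
    · rfl
    · rw [ih _ (by omega) (by omega)]
      · ring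
      · rintro rfl; omega

end RPolynomials

end

end KLS

namespace KLS

noncomputable section

variable {ι L L' : Type*} [AddCommGroup L] [AddCommGroup L'] {P : RootDatum ι L L'} (b : P.Base)

/-! ### Kazhdan-Lusztig polynomials -/

section KLPolynomials

open Polynomial LaurentPolynomial

/-- `q ^ n * f(q⁻¹)`. -/
def twistedBar (n : ℤ) : ℤ[X] →+ ℤ[T;T⁻¹] where
  toFun f := T n * invert (toLaurent f)
  map_zero' := by simp
  map_add' f g := by simp [mul_add]

theorem twistedBar_apply (n : ℤ) (f : ℤ[X]) : twistedBar n f = T n * invert (toLaurent f) := rfl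

theorem twistedBar_mul (n : ℤ) (f g : ℤ[X]) :
    twistedBar n (f * g) = twistedBar n f * invert (toLaurent g) := by
  simp [twistedBar_apply, mul_assoc]

theorem twistedBar_X_pow_mul (n : ℤ) (k : ℕ) (f : ℤ[X]) :
    twistedBar n (X ^ k * f) = twistedBar (n - k) f := by
  rw [twistedBar_apply, map_mul, map_mul, toLaurent_X_pow, invert_T, ← mul_assoc, ← T_add,
    ← sub_eq_add_neg, twistedBar_apply]

theorem twistedBar_X_mul (n : ℤ) (f : ℤ[X]) : twistedBar n (X * f) = twistedBar (n - 1) f := by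
  simpa using twistedBar_X_pow_mul n 1 f

theorem T_mul_twistedBar (m n : ℤ) (f : ℤ[X]) : T m * twistedBar n f = twistedBar (m + n) f := by
  rw [twistedBar_apply, twistedBar_apply, ← mul_assoc, T_add]

theorem coeff_twistedBar (n : ℤ) (f : ℤ[X]) (k : ℤ) :
    (twistedBar n f).coeff k = (toLaurent f).coeff (n - k) := by
  rw [twistedBar_apply, T, AddMonoidAlgebra.coeff_single_mul_apply, invert_apply]
  rw [one_mul]
  congr 1
  ring

theorem coeff_toLaurent_natCast (f : ℤ[X]) (k : ℕ) : (toLaurent f).coeff (k : ℤ) = f.coeff k := by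
  rw [coeff_toLaurent]
  exact Finsupp.mapDomain_apply Nat.cast_injective _ _

variable [Finite ι] [P.IsReduced] [IsSimplyConnected P]

/-- `p` satisfies the conditions that characterize the Kazhdan-Lusztig polynomials `P_{x,w}`. -/
structure IsKL (w : P.weylGroup) (p : P.weylGroup → ℤ[X]) : Prop where
  self : p w = 1
  coeff_eq_zero : ∀ x, x ≠ w → ∀ k, len b w ≤ 2 * k + len b x → (p x).coeff k = 0
  bar : ∀ x, toLaurent (∑ y, klR b x y * p y) = twistedBar ((len b w : ℤ) - len b x) (p x)

theorem klP_self (w : P.weylGroup) : klP b w w = 1 := by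
  rw [klP, if_pos rfl]

theorem klP_eq_zero {x w : P.weylGroup} (h : x ≠ w) (h' : len b w ≤ len b x) : klP b x w = 0 := by
  rw [klP, if_neg h, if_neg (by omega)]

variable {b} in
theorem IsKL.eq_zero {w : P.weylGroup} {p : P.weylGroup → ℤ[X]} (hp : IsKL b w p)
    {x : P.weylGroup} (h : x ≠ w) (h' : len b w ≤ len b x) : p x = 0 := by
  ext k
  rw [hp.coeff_eq_zero x h k (by omega), coeff_zero]

variable {b} in
/-- The conditions of `IsKL` determine the polynomials. -/
theorem IsKL.eq_klP {w : P.weylGroup} {p : P.weylGroup → ℤ[X]} (hp : IsKL b w p)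
    (x : P.weylGroup) : p x = klP b x w := by
  classical
  generalize hn : len b w - len b x = n
  induction n using Nat.strong_induction_on generalizing x with
  | h n ih =>
  by_cases h : x = w
  · rw [h, klP_self, hp.self]
  by_cases h' : len b x < len b w
  swap
  · rw [klP_eq_zero b h (by omega), hp.eq_zero h (by omega)]
  rw [klP, if_neg h, if_pos h']
  -- Isolate the diagonal term, where R_{x,x} = 1. Of the other terms only those with ℓ(x) < ℓ(y) ≤
  -- ℓ(w) survive, and there induction applies.
  have hsum : ∑ y, klR b x y * p y = p x + ∑ y : P.weylGroup,
      if _h : len b x < len b y ∧ len b y ≤ len b w then klR b x y * klP b y w else 0 := by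
    rw [← Finset.add_sum_erase _ _ (Finset.mem_univ x), klR_self, one_mul,
      ← Finset.add_sum_erase (a := x) Finset.univ (fun y => dite _ _ _) (Finset.mem_univ x),
      dif_neg (by omega), zero_add]
    congr 1
    refine Finset.sum_congr rfl fun y hy => ?_
    have hy := Finset.ne_of_mem_erase hy
    split_ifs with h1
    · rw [ih _ (by omega) y rfl]
    · by_cases h2 : len b x < len b y
      · rw [hp.eq_zero (by rintro rfl; omega) (by omega), mul_zero]
      · rw [klR_eq_zero b hy.symm (by omega), zero_mul]
  -- Reversal by q^{ℓ(w)-ℓ(x)} sends the allowed low degrees of p_x to degrees above half, so the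
  -- whole sum vanishes in low degrees. This determines p_x.
  have hcoeff : ∀ k, 2 * k < len b w - len b x → (∑ y, klR b x y * p y).coeff k = 0 := by
    intro k hk
    rw [← coeff_toLaurent_natCast, hp.bar, coeff_twistedBar]
    have : ((len b w : ℤ) - len b x - k) = ((len b w - len b x - k : ℕ) : ℤ) := by omega
    rw [this, coeff_toLaurent_natCast]
    exact hp.coeff_eq_zero x h _ (by omega)
  ext k
  rw [coeff_neg, finsetSum_coeff]
  simp only [coeff_monomial]
  rw [Finset.sum_ite_eq']
  split_ifs with h1
  · rw [Finset.mem_filter] at h1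
    have := hcoeff k h1.2
    rw [hsum, coeff_add] at this
    linarith
  · rw [neg_zero]
    refine hp.coeff_eq_zero x h k ?_
    by_contra h2
    exact h1 (Finset.mem_filter.mpr ⟨Finset.mem_range.mpr (by omega), by omega⟩)

/-! ### Construction of the Kazhdan-Lusztig polynomials -/

theorem sum_comp_mul_simpleRefl {M : Type*} [AddCommMonoid M] (i : b.support)
    (f : P.weylGroup → M) : ∑ y, f (y * simpleRefl b i) = ∑ y, f y :=
  Fintype.sum_equiv (Equiv.mulRight (simpleRefl b i)) _ _ fun _ => rfl

/-- Right multiplication by `T_i + 1`. -/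
def mulTAddOne (i : b.support) (p : P.weylGroup → ℤ[X]) (x : P.weylGroup) : ℤ[X] :=
  if len b (x * simpleRefl b i) < len b x then p (x * simpleRefl b i) + X * p x
  else p x + X * p (x * simpleRefl b i)

theorem mulTAddOne_mul_simpleRefl (i : b.support) (p : P.weylGroup → ℤ[X]) (x : P.weylGroup) :
    mulTAddOne b i p (x * simpleRefl b i) = mulTAddOne b i p x := by
  unfold mulTAddOne
  rw [mul_simpleRefl_cancel]
  rcases len_mul_eq_or b x i with h | h
  · rw [if_pos (by omega), if_neg (by omega)]
  · rw [if_neg (by omega), if_pos (by omega)]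

/-- Reindexing y by y s_i collects the two contributions of each p y; the recursion for R_{x,y} or
R_{x,ys_i} then matches the coefficients. -/
theorem sum_klR_mul_mulTAddOne (i : b.support) (p : P.weylGroup → ℤ[X]) (x : P.weylGroup) :
    ∑ y, klR b x y * mulTAddOne b i p y = (if len b (x * simpleRefl b i) < len b x then 1 else X) *
      (∑ y, klR b x y * p y + ∑ y, klR b (x * simpleRefl b i) y * p y) := by
  have h1 : ∀ y, klR b x y * mulTAddOne b i p y =
      (if len b (y * simpleRefl b i) < len b y then X else 1) * klR b x y * p y +
      (if len b (y * simpleRefl b i) < len b y then 1 else X) * klR b x y *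
        p (y * simpleRefl b i) := by
    intro y
    unfold mulTAddOne
    split_ifs <;> ring
  simp only [h1]
  rw [Finset.sum_add_distrib, ← sum_comp_mul_simpleRefl b i fun y =>
    (if len b (y * simpleRefl b i) < len b y then 1 else X) * klR b x y * p (y * simpleRefl b i),
    ← Finset.sum_add_distrib, ← Finset.sum_add_distrib, Finset.mul_sum]
  refine Finset.sum_congr rfl fun y _ => ?_
  rw [mul_simpleRefl_cancel]
  have hx := len_mul_eq_or b x i
  rcases len_mul_eq_or b y i with h | h
  · have h2 := klR_mul_simpleRefl b (w := y * simpleRefl b i) (i := i)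
      (by rw [mul_simpleRefl_cancel]; omega)
    rw [mul_simpleRefl_cancel] at h2
    rw [if_neg (by omega), if_pos (by omega), congrFun h2 x, rOp_apply]
    split_ifs <;> ring
  · have h2 := klR_mul_simpleRefl b (w := y) (i := i) (by omega)
    rw [if_pos (by omega), if_neg (by omega), congrFun h2 x, congrFun h2 (x * simpleRefl b i),
      rOp_apply, rOp_apply, mul_simpleRefl_cancel]
    by_cases hx' : len b (x * simpleRefl b i) < len b x
    · rw [if_pos hx', if_pos hx', if_neg (by omega)]; ring
    · rw [if_neg hx', if_neg hx', if_pos (by omega)]; ring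

/-- T_s + 1 is bar invariant up to a factor q, so multiplying by it preserves the bar identity with
the exponent raised by one. -/
theorem bar_mulTAddOne (i : b.support) {p : P.weylGroup → ℤ[X]} {n : ℤ}
    (h : ∀ x, toLaurent (∑ y, klR b x y * p y) = twistedBar (n - len b x) (p x))
    (x : P.weylGroup) :
    toLaurent (∑ y, klR b x y * mulTAddOne b i p y) =
      twistedBar (n + 1 - len b x) (mulTAddOne b i p x) := by
  rw [sum_klR_mul_mulTAddOne, map_mul, map_add, h, h, mulTAddOne]
  rcases len_mul_eq_or b x i with hx | hx
  · rw [if_neg (by omega), if_neg (by omega), toLaurent_X, mul_add, T_mul_twistedBar,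
      T_mul_twistedBar, map_add, twistedBar_X_mul, hx]
    congr 2
    · ring_nf
    · congr 1; push_cast; ring
  · rw [if_pos (by omega), if_pos (by omega), map_one, one_mul, map_add, twistedBar_X_mul, ← hx,
      add_comm]
    congr 2
    · congr 1; push_cast; ring
    · congr 1; push_cast; ring

theorem isKL_one : IsKL b (1 : P.weylGroup) (fun x => klP b x 1) := by
  classical
  have h0 : ∀ x : P.weylGroup, x ≠ 1 → klP b x 1 = 0 := fun x hx =>
    klP_eq_zero b hx (by simp)
  refine ⟨klP_self b 1, fun x hx k _ => by rw [h0 x hx, coeff_zero], fun x => ?_⟩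
  rw [Finset.sum_eq_single 1 (fun y _ hy => by rw [h0 y hy, mul_zero]) (by simp), klP_self, mul_one,
    congrFun (klR_one b) x]
  by_cases hx : x = 1
  · subst hx
    simp [klP_self, twistedBar_apply]
  · rw [Pi.single_eq_of_ne hx, h0 x hx]; simp

open Classical in
/-- The elements whose Kazhdan-Lusztig basis vectors are subtracted in the construction of the
Kazhdan-Lusztig basis vector of `v s_i`. -/
def klLower (v : P.weylGroup) (i : b.support) : Finset P.weylGroup :=
  Finset.univ.filter fun z => len b (z * simpleRefl b i) < len b z ∧ len b z < len b v ∧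
    Odd (len b v - len b z)

/-- The polynomials `P_{x, v s_i}`, constructed from those for shorter elements. -/
def klStep (v : P.weylGroup) (i : b.support) (x : P.weylGroup) : ℤ[X] :=
  mulTAddOne b i (fun y => klP b y v) x - ∑ z ∈ klLower b v i,
    Polynomial.C ((klP b z v).coeff ((len b v - len b z - 1) / 2)) *
      (X ^ ((len b v - len b z + 1) / 2) * klP b x z)

-- Every subtracted z has s_i as a right descent, so its polynomials are already invariant under x ↦
-- x s_i.
variable {b} in
theorem klStep_mul_simpleRefl {v : P.weylGroup} {i : b.support}
    (h : ∀ z, len b z < len b v → len b (z * simpleRefl b i) < len b z →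
      ∀ x, klP b (x * simpleRefl b i) z = klP b x z) (x : P.weylGroup) :
    klStep b v i (x * simpleRefl b i) = klStep b v i x := by
  rw [klStep, mulTAddOne_mul_simpleRefl, klStep]
  congr 1
  refine Finset.sum_congr rfl fun z hz => ?_
  rw [klLower, Finset.mem_filter] at hz
  rw [h z hz.2.2.1 hz.2.1]

-- For x s_i < x, the only coefficient that can break the degree bound is the top one of X P_{x,v},
-- which is μ(x,v). The subtracted term with z = x removes exactly it; terms with z ≠ x obey the
-- bound by themselves.
variable {b} in
theorem coeff_klStep {v : P.weylGroup} {i : b.support}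
    (hv : len b v < len b (v * simpleRefl b i)) (h₁ : IsKL b v fun x => klP b x v)
    (h₂ : ∀ z, len b z < len b v → IsKL b z fun x => klP b x z) {x : P.weylGroup}
    (hx : len b (x * simpleRefl b i) < len b x) (hxv : x ≠ v * simpleRefl b i) {k : ℕ}
    (hk : len b v + 1 ≤ 2 * k + len b x) : (klStep b v i x).coeff k = 0 := by
  classical
  have hx' := len_mul_eq_or b x i
  have h3 : x ≠ v := by rintro rfl; omega
  have h4 : x * simpleRefl b i ≠ v := by rintro rfl; exact hxv (by simp)
  rw [klStep, mulTAddOne, if_pos hx, coeff_sub, coeff_add,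
    h₁.coeff_eq_zero _ h4 k (by omega), zero_add, finsetSum_coeff]
  simp only [coeff_C_mul, coeff_X_pow_mul']
  have h5 : ∀ z ∈ klLower b v i, z ≠ x → ((klP b z v).coeff ((len b v - len b z - 1) / 2) *
      if (len b v - len b z + 1) / 2 ≤ k then (klP b x z).coeff (k - (len b v - len b z + 1) / 2)
      else 0) = 0 := by
    intro z hz hzx
    rw [klLower, Finset.mem_filter] at hz
    obtain ⟨-, hz1, hz2, m, hm⟩ := hz
    split_ifs with h6
    · rw [(h₂ z hz2).coeff_eq_zero x hzx.symm _ (by omega), mul_zero]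
    · rw [mul_zero]
  by_cases h7 : x ∈ klLower b v i
  · rw [Finset.sum_eq_single_of_mem x h7 h5, klP_self, coeff_one]
    rw [klLower, Finset.mem_filter] at h7
    obtain ⟨-, -, hz2, m, hm⟩ := h7
    obtain ⟨k, rfl⟩ : ∃ j, k = j + 1 := ⟨k - 1, by omega⟩
    rw [coeff_X_mul]
    by_cases h8 : k = m
    · subst h8
      have h9 : (len b v - len b x - 1) / 2 = k := by omega
      have h10 : (len b v - len b x + 1) / 2 = k + 1 := by omega
      rw [h9, h10, if_pos le_rfl, Nat.sub_self, if_pos rfl, mul_one, sub_self]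
    · rw [h₁.coeff_eq_zero x h3 k (by omega), zero_sub, neg_eq_zero]
      rw [if_pos (by omega), if_neg (by omega), mul_zero]
  · rw [Finset.sum_eq_zero fun z hz => h5 z hz fun h => h7 (h ▸ hz), sub_zero]
    rcases k with _ | k
    · simp
    rw [coeff_X_mul]
    by_cases h8 : len b v ≤ 2 * k + len b x
    · exact h₁.coeff_eq_zero x h3 k h8
    · refine absurd ?_ h7
      rw [klLower, Finset.mem_filter]
      exact ⟨Finset.mem_univ _, hx, by omega, ⟨k, by omega⟩⟩

variable {b} in
theorem isKL_klStep {v : P.weylGroup} {i : b.support}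
    (hv : len b v < len b (v * simpleRefl b i)) (h₁ : IsKL b v fun x => klP b x v)
    (h₂ : ∀ z, len b z < len b v → IsKL b z fun x => klP b x z)
    (h₃ : ∀ z, len b z < len b v → len b (z * simpleRefl b i) < len b z →
      ∀ x, klP b (x * simpleRefl b i) z = klP b x z) :
    IsKL b (v * simpleRefl b i) (klStep b v i) := by
  classical
  have hv' := len_mul_eq_or b v i
  have hself : klStep b v i (v * simpleRefl b i) = 1 := by
    rw [klStep, mulTAddOne, mul_simpleRefl_cancel, if_pos hv, klP_self,
      klP_eq_zero b (fun h => by rw [h] at hv; omega) hv.le, mul_zero, add_zero,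
      Finset.sum_eq_zero, sub_zero]
    intro z hz
    rw [klLower, Finset.mem_filter] at hz
    rw [klP_eq_zero b (x := v * simpleRefl b i) (w := z) (by rintro rfl; omega) (by omega),
      mul_zero, mul_zero]
  refine ⟨hself, fun x hx k hk => ?_, fun x => ?_⟩
  · rcases len_mul_eq_or b x i with h | h
    -- When x s_i is longer than x, pass to x s_i, where the degree bound is stronger. If x = v the
    -- value there is 1, and the hypothesis on k excludes degree 0.
    · rw [← klStep_mul_simpleRefl h₃]
      by_cases hxv : x = v
      · subst hxv
        rw [hself, coeff_one, if_neg (by omega)]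
      · exact coeff_klStep hv h₁ h₂ (by rw [mul_simpleRefl_cancel]; omega)
          (fun h => hxv (mul_right_cancel h)) (by omega)
    · exact coeff_klStep hv h₁ h₂ (by omega) hx (by omega)
  · have e : ((len b (v * simpleRefl b i) : ℤ) - len b x) = (len b v : ℤ) + 1 - len b x := by omega
    simp only [klStep, mul_sub, Finset.sum_sub_distrib, map_sub]
    rw [bar_mulTAddOne b i h₁.bar x, e]
    congr 1
    simp only [Finset.mul_sum]
    rw [Finset.sum_comm, map_sum, map_sum]
    refine Finset.sum_congr rfl fun z hz => ?_
    rw [klLower, Finset.mem_filter] at hz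
    obtain ⟨-, hz1, hz2, m, hm⟩ := hz
    have h5 := (h₂ z hz2).bar x
    have h6 : (len b v - len b z + 1) / 2 = m + 1 := by omega
    rw [h6, mul_comm (Polynomial.C _), twistedBar_mul, twistedBar_X_pow_mul]
    have h7 : ∀ y, klR b x y * (Polynomial.C ((klP b z v).coeff ((len b v - len b z - 1) / 2)) *
        (X ^ (m + 1) * klP b y z)) = (klR b x y * klP b y z) * (X ^ (m + 1) *
          Polynomial.C ((klP b z v).coeff ((len b v - len b z - 1) / 2))) := fun y => by ring
    simp only [h7]
    rw [← Finset.sum_mul, map_mul, h5, map_mul, toLaurent_X_pow, toLaurent_C, invert_C, ← mul_assoc,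
      mul_comm _ (T _), T_mul_twistedBar]
    congr 2
    congr 1
    push_cast
    omega

/-- The polynomials `klP` are the Kazhdan-Lusztig polynomials, and `P_{x s, w} = P_{x, w}` if
`w s < w`. -/
theorem isKL_klP_and (w : P.weylGroup) : IsKL b w (fun x => klP b x w) ∧
    ∀ i, len b (w * simpleRefl b i) < len b w →
      ∀ x, klP b (x * simpleRefl b i) w = klP b x w := by
  generalize hn : len b w = n
  induction n using Nat.strong_induction_on generalizing w with
  | h n ih =>
  have step : ∀ i, len b (w * simpleRefl b i) < len b w → IsKL b w (fun x => klP b x w) ∧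
      ∀ x, klP b (x * simpleRefl b i) w = klP b x w := by
    intro i hi
    have h3 : ∀ z, len b z < len b (w * simpleRefl b i) → len b (z * simpleRefl b i) < len b z →
        ∀ x, klP b (x * simpleRefl b i) z = klP b x z := fun z hz hz' =>
      (ih _ (by omega) z rfl).2 i hz'
    have h := isKL_klStep (v := w * simpleRefl b i) (i := i)
      (by rw [mul_simpleRefl_cancel]; exact hi) (ih _ (by omega) _ rfl).1
      (fun z hz => (ih _ (by omega) z rfl).1) h3
    rw [mul_simpleRefl_cancel] at h
    have h4 : klStep b (w * simpleRefl b i) i = fun x => klP b x w := funext h.eq_klP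
    refine ⟨h4 ▸ h, fun x => ?_⟩
    have h5 := klStep_mul_simpleRefl h3 x
    rwa [congrFun h4, congrFun h4] at h5
  refine ⟨?_, fun i hi => (step i (by omega)).2⟩
  by_cases hw : w = 1
  · rw [hw]; exact isKL_one b
  · obtain ⟨i, hi⟩ := exists_descent b hw
    exact (step i hi).1

theorem isKL_klP (w : P.weylGroup) : IsKL b w fun x => klP b x w := (isKL_klP_and b w).1

/-! ### Descent invariance and inversion -/

theorem klP_mul_simpleRefl {w : P.weylGroup} {i : b.support}
    (h : len b (w * simpleRefl b i) < len b w) (x : P.weylGroup) :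
    klP b (x * simpleRefl b i) w = klP b x w := (isKL_klP_and b w).2 i h x

/-- Inversion preserves lengths and R-polynomials, so the inverted family satisfies the same
characterization and uniqueness applies. -/
theorem klP_inv (x w : P.weylGroup) : klP b x⁻¹ w⁻¹ = klP b x w := by
  have h : IsKL b w fun x => klP b x⁻¹ w⁻¹ := by
    have h1 := isKL_klP b w⁻¹
    refine ⟨klP_self b _, fun x hx k hk => h1.coeff_eq_zero _ (by simpa using hx) k (by
      rwa [len_inv, len_inv]), fun x => ?_⟩
    have h2 := h1.bar x⁻¹
    rw [len_inv, len_inv] at h2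
    rw [← h2]
    congr 1
    refine Fintype.sum_equiv (Equiv.inv P.weylGroup) _ _ fun y => ?_
    rw [Equiv.inv_apply, klR_inv]
  exact h.eq_klP x

theorem klP_simpleRefl_mul {w : P.weylGroup} {i : b.support}
    (h : len b (simpleRefl b i * w) < len b w) (x : P.weylGroup) :
    klP b (simpleRefl b i * x) w = klP b x w := by
  rw [← klP_inv, ← klP_inv b x, mul_inv_rev, simpleRefl_inv]
  exact klP_mul_simpleRefl b (by rwa [len_inv, ← len_simpleRefl_mul]) _

/-! ### Right descent sets on left cells -/

theorem mem_rightDescent_iff {w : P.weylGroup} {i : b.support} :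
    i ∈ rightDescent b w ↔ len b (w * simpleRefl b i) < len b w := by
  simp [rightDescent]

theorem mem_leftDescent_iff {w : P.weylGroup} {i : b.support} :
    i ∈ leftDescent b w ↔ len b (simpleRefl b i * w) < len b w := by
  simp [leftDescent]

-- μ(x,w) is the highest coefficient the degree bound allows at x. At a longer y ≠ w the bound would
-- force that coefficient of the same polynomial to vanish.
variable {b} in
theorem eq_of_klMu_ne_zero {x y w : P.weylGroup} (h : klMu b x w ≠ 0) (hy : len b x < len b y)
    (hP : klP b y w = klP b x w) : y = w := by
  by_contra hne
  unfold klMu at h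
  split_ifs at h with h'
  · obtain ⟨hl, m, hm⟩ := h'
    rw [← hP, (isKL_klP b w).coeff_eq_zero y hne _ (by omega)] at h
    exact h rfl
  · exact h rfl

-- Let i be a left descent of y but not of z. If μ(y,z) ≠ 0, a right descent j of z missing from y
-- would give z = y s_j, and then s_i z would be shorter than z. If μ(z,y) ≠ 0, then y = s_i z is
-- longer than z, and left multiplication that lengthens keeps right descents.
variable {b} in
theorem rightDescent_subset_of_klMu {y z : P.weylGroup} (h : klMu b y z ≠ 0 ∨ klMu b z y ≠ 0)
    (h' : ¬ leftDescent b y ⊆ leftDescent b z) : rightDescent b z ⊆ rightDescent b y := by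
  obtain ⟨i, hi, hi'⟩ := Finset.not_subset.mp h'
  rw [mem_leftDescent_iff] at hi hi'
  rcases h with h | h
  · intro j hj
    by_contra hj'
    rw [mem_rightDescent_iff] at hj hj'
    have h1 := len_mul_eq_or b y j
    have h2 := eq_of_klMu_ne_zero h (y := y * simpleRefl b j) (by omega) (klP_mul_simpleRefl b hj y)
    have h3 := len_mul_simpleRefl_le b (simpleRefl b i * y) j
    rw [← h2, ← mul_assoc] at hi'
    omega
  · have h1 := len_simpleRefl_mul_eq_or b z i
    have h2 := eq_of_klMu_ne_zero h (y := simpleRefl b i * z) (by omega)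
      (klP_simpleRefl_mul b hi z)
    intro j hj
    rw [mem_rightDescent_iff] at hj ⊢
    have h3 := len_simpleRefl_mul_eq_or b (z * simpleRefl b j) i
    rw [← h2, mul_assoc]
    omega

variable {b} in
theorem rightDescent_subset_of_leftLE {x w : P.weylGroup} (h : leftLE b x w) :
    rightDescent b w ⊆ rightDescent b x := by
  induction h with
  | refl => exact subset_rfl
  | tail _ h ih => exact (rightDescent_subset_of_klMu h.1 h.2).trans ih

variable {b} in
theorem SameLeftCell.rightDescent_eq {x w : P.weylGroup} (h : SameLeftCell b x w) :
    rightDescent b x = rightDescent b w :=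
  (rightDescent_subset_of_leftLE h.2).antisymm (rightDescent_subset_of_leftLE h.1)

end KLPolynomials

end

end KLS

namespace KLS

noncomputable section

variable {ι L L' : Type*} [AddCommGroup L] [AddCommGroup L'] {P : RootDatum ι L L'} (b : P.Base)

/-! ### Dominant weights and the dominance order -/

section Weights

variable [Finite ι] [P.IsReduced] [IsSimplyConnected P] [Module.Free ℤ L]

/-- Positivity is defined through roots, while dominance is tested on coroots. Following both along
simple reflections shows that they agree, so coroots of positive roots are natural combinations of
simple coroots. -/
theorem isPos_flip_iff (k : ι) :
    RootPairing.Base.IsPos (P := P.flip) b.flip k ↔ b.IsPos k := by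
  have : Module.Free ℤ L' := Module.Free.of_basis (corootBasis b)
  have hr : P.flip.IsReduced := inferInstance
  have key : ∀ j ∈ b.support, ∀ k, (RootPairing.Base.IsPos (P := P.flip) b.flip k ↔ b.IsPos k) →
      (RootPairing.Base.IsPos (P := P.flip) b.flip (P.reflectionPerm j k) ↔
        b.IsPos (P.reflectionPerm j k)) := by
    intro j hj k hk
    have hself : P.root (P.reflectionPerm j j) = -P.root j := by simp
    have hself' : P.flip.root (P.reflectionPerm j j) = -P.flip.root j := by simp
    have hp : b.IsPos j := RootPairing.Base.isPos_of_mem_support hj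
    have hp' : RootPairing.Base.IsPos (P := P.flip) b.flip j :=
      RootPairing.Base.isPos_of_mem_support (b := b.flip) hj
    by_cases h1 : k = j
    · subst h1
      rw [isPos_of_root_eq_neg b hself,
        isPos_of_root_eq_neg (P := P.flip) b.flip hself', hk]
    by_cases h2 : P.root k = -P.root j
    · have h3 : k = P.reflectionPerm j j := P.root.injective (h2.trans hself.symm)
      subst h3
      rw [P.reflectionPerm_self]
      exact iff_of_true hp' hp
    · have h3 : P.flip.root k ≠ -P.flip.root j := by
        intro h3
        apply h2
        rw [← hself]
        congr 1
        exact P.coroot.injective (h3.trans hself'.symm)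
      have h4 := isPos_simpleRefl_smul_iff b ⟨j, hj⟩ h1 h2
      have h5 := isPos_simpleRefl_smul_iff (P := P.flip) b.flip ⟨j, hj⟩ h1 h3
      exact h5.trans (hk.trans h4.symm)
  refine RootPairing.Base.induction_reflect (b := b) k
    (p := fun k => RootPairing.Base.IsPos (P := P.flip) b.flip k ↔ b.IsPos k) ?_ ?_ ?_
  · intro i hi
    rw [isPos_of_root_eq_neg b (k := i) (by simp),
      isPos_of_root_eq_neg (P := P.flip) b.flip (k := i) (by simp), hi]
  · intro i hi
    exact iff_of_true (RootPairing.Base.isPos_of_mem_support (b := b.flip) hi)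
      (RootPairing.Base.isPos_of_mem_support hi)
  · exact fun i j h hj => key j hj i h

theorem exists_nat_coroot_eq {k : ι} (h : b.IsPos k) :
    ∃ m : b.support → ℕ, P.coroot k = ∑ j, m j • P.coroot j := by
  have : Module.Free ℤ L' := Module.Free.of_basis (corootBasis b)
  have hr : P.flip.IsReduced := inferInstance
  have h1 := (isPos_iff_mem_closure (P := P.flip) b.flip k).mp ((isPos_flip_iff b k).mpr h)
  rw [← Submodule.span_nat_eq_addSubmonoidClosure, Submodule.mem_toAddSubmonoid,
    Set.image_eq_range, Submodule.mem_span_range_iff_exists_fun] at h1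
  obtain ⟨c, hc⟩ := h1
  exact ⟨c, hc.symm⟩

variable {b} in
theorem Dominant.nonneg {x : L} (hx : Dominant b x) {k : ι} (hk : b.IsPos k) :
    0 ≤ P.toLinearMap x (P.coroot k) := by
  obtain ⟨m, hm⟩ := exists_nat_coroot_eq b hk
  rw [hm, map_sum]
  refine Finset.sum_nonneg fun j _ => ?_
  rw [map_nsmul]
  exact nsmul_nonneg (hx j) _

variable {b} in
theorem Dominant.nonpos {x : L} (hx : Dominant b x) {k : ι} (hk : ¬ b.IsPos k) :
    P.toLinearMap x (P.coroot k) ≤ 0 := by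
  letI := P.indexNeg
  have := hx.nonneg ((RootPairing.Base.IsPos.neg_iff_not b k).mpr hk)
  simpa using this

open Classical in
theorem omega_coroot (I : Finset b.support) (j : b.support) :
    P.toLinearMap (omega b I) (P.coroot j) = if j ∈ I then 1 else 0 := by
  rw [omega, map_sum, LinearMap.sum_apply]
  simp only [fundWeight_coroot]
  rw [Finset.sum_ite_eq']

theorem rho_coroot (j : b.support) : P.toLinearMap (rho b) (P.coroot j) = 1 := by
  classical
  rw [rho, omega_coroot, if_pos (Finset.mem_univ j)]

theorem dominant_omega (I : Finset b.support) : Dominant b (omega b I) := by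
  classical
  intro j
  rw [omega_coroot]
  split_ifs <;> simp

theorem dominant_rho : Dominant b (rho b) := dominant_omega b _

variable {b} in
theorem Dominant.nsmul {x : L} (hx : Dominant b x) (n : ℕ) : Dominant b (n • x) := by
  intro j
  rw [map_nsmul, LinearMap.smul_apply]
  exact nsmul_nonneg (hx j) _

open Classical in
theorem omega_add_omega_compl (I : Finset b.support) : omega b I + omega b Iᶜ = rho b :=
  Finset.sum_add_sum_compl I _

theorem isPos_iff_rho_pos (k : ι) : b.IsPos k ↔ 0 < P.toLinearMap (rho b) (P.coroot k) := by
  constructor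
  · intro h
    obtain ⟨m, hm⟩ := exists_nat_coroot_eq b h
    rw [hm, map_sum]
    simp only [map_nsmul, rho_coroot]
    by_contra h1
    have h2 : ∑ j, m j • (1 : ℤ) = 0 :=
      le_antisymm (not_lt.mp h1) (Finset.sum_nonneg fun j _ => nsmul_nonneg zero_le_one _)
    rw [Finset.sum_eq_zero_iff_of_nonneg fun j _ => nsmul_nonneg zero_le_one _] at h2
    apply P.flip.ne_zero k
    change P.coroot k = 0
    rw [hm]
    refine Finset.sum_eq_zero fun j hj => ?_
    have := h2 j hj
    have h3 : m j = 0 := by simpa using this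
    rw [h3, zero_smul]
  · intro h
    by_contra h1
    exact absurd ((dominant_rho b).nonpos h1) (not_le.mpr h)

theorem eq_of_forall_coroot {x y : L}
    (h : ∀ i : b.support, P.toLinearMap x (P.coroot i) = P.toLinearMap y (P.coroot i)) :
    x = y := by
  apply P.toLinearMap.toPerfPair.injective
  refine (corootBasis b).ext fun i => ?_
  have : corootBasis b i = P.coroot i := by rw [corootBasis, Module.Basis.mk_apply]
  rw [this]
  exact h i

theorem omega_injective {I J : Finset b.support} (h : omega b I = omega b J) : I = J := by
  classical
  ext i
  have h1 := omega_coroot b I i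
  rw [h, omega_coroot] at h1
  by_cases h2 : i ∈ I <;> by_cases h3 : i ∈ J <;> simp_all

/-- The monoid spanned by the simple roots. -/
def simpleCone : AddSubmonoid L := AddSubmonoid.closure (P.root '' b.support)

/-- The weights with a positive multiple in the monoid spanned by the simple roots. -/
def ratCone : AddSubmonoid L where
  carrier := {x | ∃ n : ℕ, 0 < n ∧ n • x ∈ simpleCone b}
  zero_mem' := ⟨1, one_pos, by simp⟩
  add_mem' := by
    rintro x y ⟨n, hn, hx⟩ ⟨m, hm, hy⟩
    refine ⟨n * m, Nat.mul_pos hn hm, ?_⟩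
    rw [smul_add, mul_comm, mul_smul, mul_comm, mul_smul]
    exact add_mem (nsmul_mem hx m) (nsmul_mem hy n)

variable {b} in
theorem mem_ratCone_of_mem {x : L} (h : x ∈ simpleCone b) : x ∈ ratCone b :=
  ⟨1, one_pos, by simpa using h⟩

variable {b} in
theorem mem_ratCone_of_nsmul {x : L} {n : ℕ} (hn : 0 < n) (h : n • x ∈ ratCone b) :
    x ∈ ratCone b := by
  obtain ⟨m, hm, h⟩ := h
  exact ⟨m * n, Nat.mul_pos hm hn, by rwa [mul_smul]⟩

theorem root_mem_simpleCone {k : ι} (h : b.IsPos k) : P.root k ∈ simpleCone b :=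
  (isPos_iff_mem_closure b k).mp h

variable {b} in
theorem exists_nat_of_mem_simpleCone {x : L} (h : x ∈ simpleCone b) :
    ∃ c : b.support → ℕ, x = ∑ i, c i • P.root i := by
  rw [simpleCone, ← Submodule.span_nat_eq_addSubmonoidClosure, Submodule.mem_toAddSubmonoid,
    Set.image_eq_range, Submodule.mem_span_range_iff_exists_fun] at h
  obtain ⟨c, hc⟩ := h
  exact ⟨c, hc.symm⟩

variable {b} in
theorem eq_zero_of_mem_simpleCone {x : L} (h : x ∈ simpleCone b) (h' : -x ∈ simpleCone b) :
    x = 0 := by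
  obtain ⟨c, hc⟩ := exists_nat_of_mem_simpleCone h
  obtain ⟨d, hd⟩ := exists_nat_of_mem_simpleCone h'
  have h1 : ∑ i : b.support, ((c i + d i : ℕ) : ℤ) • P.root i = 0 := by
    simp only [natCast_zsmul, add_smul]
    rw [Finset.sum_add_distrib, ← hc, ← hd, add_neg_cancel]
  have h2 := Fintype.linearIndependent_iff.mp
    (show LinearIndependent ℤ fun i : b.support => P.root i from b.linearIndepOn_root) _ h1
  rw [hc]
  refine Finset.sum_eq_zero fun i _ => ?_
  have h3 := h2 i
  have h4 : c i = 0 := by omega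
  rw [h4, zero_smul]

variable {b} in
theorem Dominant.sub_smul_mem {x : L} (hx : Dominant b x) (w : P.weylGroup) :
    x - w • x ∈ simpleCone b := by
  generalize hn : len b w = n
  induction n generalizing w with
  | zero => rw [eq_one_of_len_eq_zero b hn, one_smul, sub_self]; exact zero_mem _
  | succ n ih =>
    obtain ⟨i, hi⟩ := exists_descent b (w := w) (by rintro rfl; simp at hn)
    have h1 := len_mul_eq_or b w i
    have h2 := ih (w * simpleRefl b i) (by omega)
    have h3 : b.IsPos ((w * simpleRefl b i) • (i : ι)) := by
      by_contra h
      have := (len_mul_lt_iff b _ i).mpr h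
      rw [mul_simpleRefl_cancel] at this
      omega
    have h4 : x - w • x = x - (w * simpleRefl b i) • x +
        (P.toLinearMap x (P.coroot i)) • P.root ((w * simpleRefl b i) • (i : ι)) := by
      have h5 : w • x = (w * simpleRefl b i) • (simpleRefl b i • x) := by
        rw [smul_smul, mul_simpleRefl_cancel]
      rw [h5, simpleRefl_smul, smul_sub, root_smul, smul_comm]
      abel
    rw [h4]
    refine add_mem h2 ?_
    obtain ⟨m, hm⟩ := Int.eq_ofNat_of_zero_le (hx i)
    rw [hm, natCast_zsmul]
    exact nsmul_mem (root_mem_simpleCone b h3) m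

/-- The orbit sum is fixed by each simple reflection, hence kills every simple coroot, and these
span the cocharacter lattice. -/
theorem sum_smul_eq_zero (b : P.Base) (x : L) : ∑ w : P.weylGroup, w • x = 0 := by
  apply eq_of_forall_coroot b
  intro i
  have h : simpleRefl b i • ∑ w : P.weylGroup, w • x = ∑ w : P.weylGroup, w • x := by
    rw [Finset.smul_sum]
    exact Fintype.sum_equiv (Equiv.mulLeft (simpleRefl b i)) _ _ fun w => by
      rw [smul_smul]; rfl
  have h1 := toLinearMap_smul_coroot_smul (simpleRefl b i) (∑ w : P.weylGroup, w • x) (i : ι)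
  rw [h] at h1
  have h2 : P.coroot (simpleRefl b i • (i : ι)) = -P.coroot i := by
    rw [simpleRefl_smul_index]; simp
  rw [h2, map_neg] at h1
  rw [map_zero, LinearMap.zero_apply]
  omega

-- Summing the hypotheses over W leaves |W| x, since the conjugates of y cancel; the cone is
-- saturated.
variable {b} in
theorem mem_ratCone_of_forall_sub {x y : L} (h : ∀ w : P.weylGroup, x - w • y ∈ ratCone b) :
    x ∈ ratCone b := by
  refine mem_ratCone_of_nsmul (n := Fintype.card P.weylGroup) Fintype.card_pos ?_
  have h1 : ∑ w : P.weylGroup, (x - w • y) = Fintype.card P.weylGroup • x := by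
    rw [Finset.sum_sub_distrib, sum_smul_eq_zero b, sub_zero, Finset.sum_const, Finset.card_univ]
  rw [← h1]
  exact sum_mem fun w _ => h w

variable {b} in
theorem Dominant.mem_ratCone {x : L} (hx : Dominant b x) : x ∈ ratCone b :=
  mem_ratCone_of_forall_sub fun w => mem_ratCone_of_mem (hx.sub_smul_mem w)

variable {b} in
theorem eq_zero_of_mem_ratCone {x : L} (h : x ∈ ratCone b) (h' : -x ∈ ratCone b) : x = 0 := by
  obtain ⟨n, hn, h⟩ := h
  obtain ⟨m, hm, h'⟩ := h'
  have h1 := eq_zero_of_mem_simpleCone (b := b) (x := (m * n) • x)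
    (by rw [mul_smul]; exact nsmul_mem h m)
    (by rw [mul_comm, mul_smul, ← smul_neg, ← smul_neg]; exact nsmul_mem h' n)
  have : IsAddTorsionFree L := Module.isTorsionFree_int_iff_isAddTorsionFree.mp inferInstance
  exact (nsmul_eq_zero_iff_right (Nat.mul_pos hm hn).ne').mp h1

variable {b} in
theorem eq_of_sub_mem_ratCone {x y : L} (h : x - y ∈ ratCone b) (h' : y - x ∈ ratCone b) :
    x = y :=
  sub_eq_zero.mp (eq_zero_of_mem_ratCone h (by rwa [neg_sub]))

theorem exists_dominant_smul (x : L) : ∃ w : P.weylGroup, Dominant b (w • x) := by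
  -- `r v w` says that v x is strictly larger than w x, so an `r`-minimal element gives a maximal
  -- conjugate. A negative value on a simple coroot would let a reflection increase it further.
  let r : P.weylGroup → P.weylGroup → Prop := fun v w =>
    v • x - w • x ∈ ratCone b ∧ v • x ≠ w • x
  have : IsTrans _ r := ⟨fun u v w h h' => ⟨by
      have := add_mem h.1 h'.1
      rwa [sub_add_sub_cancel] at this, fun h3 => h.2 (eq_of_sub_mem_ratCone h.1 (by
      rw [h3]; exact h'.1))⟩⟩
  have : Std.Irrefl r := ⟨fun w h => h.2 rfl⟩
  obtain ⟨w, -, hw⟩ := (Finite.wellFounded_of_trans_of_irrefl r).has_min Set.univ ⟨1, trivial⟩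
  refine ⟨w, fun i => ?_⟩
  by_contra h
  push Not at h
  refine hw (simpleRefl b i * w) trivial ?_
  obtain ⟨m, hm⟩ := Int.eq_ofNat_of_zero_le (a := -(P.toLinearMap (w • x) (P.coroot i))) (by omega)
  have h1 : (simpleRefl b i * w) • x - w • x = m • P.root i := by
    rw [mul_smul, simpleRefl_smul, ← natCast_zsmul, ← hm, neg_smul]
    abel
  refine ⟨?_, ?_⟩
  · rw [h1]
    exact mem_ratCone_of_mem (nsmul_mem (root_mem_simpleCone b (isPos_simple b i)) m)
  · rw [← sub_ne_zero, h1]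
    have : IsAddTorsionFree L := Module.isTorsionFree_int_iff_isAddTorsionFree.mp inferInstance
    exact fun h2 => P.ne_zero i ((nsmul_eq_zero_iff_right (by omega)).mp h2)

/-- The weights all of whose Weyl group conjugates are at most `y`. -/
def hull (y : L) : Set L := {z | ∀ w : P.weylGroup, y - w • z ∈ ratCone b}

variable {b}

theorem smul_mem_hull {y z : L} (h : z ∈ hull b y) (w : P.weylGroup) : w • z ∈ hull b y := by
  intro v
  rw [smul_smul]
  exact h _

theorem add_mem_hull {y z y' z' : L} (h : z ∈ hull b y) (h' : z' ∈ hull b y') :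
    z + z' ∈ hull b (y + y') := by
  intro w
  rw [smul_add, add_sub_add_comm]
  exact add_mem (h w) (h' w)

theorem hull_mono {x y : L} (h : y - x ∈ ratCone b) : hull b x ⊆ hull b y := by
  intro z hz w
  have := add_mem h (hz w)
  rwa [sub_add_sub_cancel] at this

theorem Dominant.mem_hull {x : L} (hx : Dominant b x) : x ∈ hull b x :=
  fun w => mem_ratCone_of_mem (hx.sub_smul_mem w)

theorem Dominant.mem_hull_of_sub {x y : L} (hx : Dominant b x) (h : y - x ∈ ratCone b) :
    x ∈ hull b y := hull_mono h hx.mem_hull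

theorem mem_ratCone_of_mem_hull {y z : L} (h : z ∈ hull b y) : y ∈ ratCone b :=
  mem_ratCone_of_forall_sub h

theorem sub_mem_of_mem_hull {y z : L} (h : z ∈ hull b y) : y - z ∈ ratCone b := by
  simpa using h 1

theorem eq_zero_of_mem_hull_zero {z : L} (h : z ∈ hull b 0) : z = 0 := by
  have h1 : ∀ w : P.weylGroup, -(w • z) ∈ ratCone b := fun w => by simpa using h w
  refine eq_zero_of_mem_ratCone ?_ (by simpa using h1 1)
  refine mem_ratCone_of_forall_sub (y := z) fun w => ?_
  classical
  by_cases hw : w = 1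
  · rw [hw, one_smul, sub_self]; exact zero_mem _
  have h2 : z - w • z = ∑ v ∈ (Finset.univ.erase (1 : P.weylGroup)), -(v • z) + -(w • z) := by
    have h3 := sum_smul_eq_zero b z
    rw [← Finset.add_sum_erase _ _ (Finset.mem_univ 1), one_smul] at h3
    rw [Finset.sum_neg_distrib, ← eq_neg_of_add_eq_zero_left h3, sub_eq_add_neg]
  rw [h2]
  exact add_mem (sum_mem fun v _ => h1 v) (h1 w)

variable (b) in
theorem longest_smul_rho : longest b • rho b = -rho b := by
  have hd : ∀ x : L, Dominant b x → Dominant b (-(longest b • x)) := by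
    intro x hx i
    rw [map_neg, LinearMap.neg_apply, toLinearMap_smul_coroot, longest_inv, neg_nonneg]
    exact hx.nonpos (not_isPos_longest_smul_simple b i)
  -- -w₀ρ is dominant regular, so d is dominant. The map -w₀ preserves dominance and sends d to -d,
  -- so both d and -d lie in the pointed cone.
  set d := -(longest b • rho b) - rho b with hdef
  have h1 : Dominant b d := by
    intro i
    rw [hdef, map_sub, map_neg, LinearMap.sub_apply, LinearMap.neg_apply, rho_coroot,
      toLinearMap_smul_coroot, longest_inv]
    have h2 := (isPos_iff_rho_pos b (longest b • (i : ι))).not.mp (not_isPos_longest_smul_simple b i)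
    have h3 : P.toLinearMap (rho b) (P.coroot (longest b • (i : ι))) ≠ 0 := by
      letI := P.indexNeg
      intro h4
      have h5 := (isPos_iff_rho_pos b (-(longest b • (i : ι)))).mp
        ((RootPairing.Base.IsPos.neg_iff_not b _).mpr (not_isPos_longest_smul_simple b i))
      simp [h4] at h5
    omega
  have h2 : -(longest b • d) = -d := by
    rw [hdef, smul_sub, smul_neg, smul_smul, longest_mul_self, one_smul]
    abel
  have h3 := hd d h1
  rw [h2] at h3
  have h4 : d = 0 := eq_zero_of_mem_ratCone h1.mem_ratCone h3.mem_ratCone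
  rw [hdef, sub_eq_zero, neg_eq_iff_eq_neg] at h4
  exact h4

theorem longest_smul_mem_simpleCone {x : L} (h : x ∈ simpleCone b) :
    -(longest b • x) ∈ simpleCone b := by
  induction h using AddSubmonoid.closure_induction with
  | zero => simp
  | add x y _ _ hx hy => rw [smul_add, neg_add]; exact add_mem hx hy
  | mem x hx =>
    obtain ⟨i, hi, rfl⟩ := hx
    rw [← root_smul]
    refine (b.root_mem_or_neg_mem (longest b • i)).resolve_left ?_
    rw [← isPos_iff_mem_closure]
    exact not_isPos_longest_smul_simple b ⟨i, hi⟩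

theorem longest_smul_mem_ratCone {x : L} (h : x ∈ ratCone b) :
    -(longest b • x) ∈ ratCone b := by
  obtain ⟨n, hn, h⟩ := h
  refine ⟨n, hn, ?_⟩
  have := longest_smul_mem_simpleCone h
  rwa [smul_comm, ← smul_neg] at this

/-- The map -w₀ preserves the cone and fixes ρ, so it turns the bound for w₀ w z into the bound for
-w z. -/
theorem neg_mem_hull_rho {z : L} (h : z ∈ hull b (rho b)) : -z ∈ hull b (rho b) := by
  intro w
  have := longest_smul_mem_ratCone (h (longest b * w))
  rw [smul_sub, smul_smul, ← mul_assoc, longest_mul_self, one_mul, longest_smul_rho, neg_sub,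
    sub_neg_eq_add, add_comm] at this
  rwa [smul_neg, sub_neg_eq_add]

theorem omega_mem_hull_rho (I : Finset b.support) : omega b I ∈ hull b (rho b) := by
  classical
  refine (dominant_omega b I).mem_hull_of_sub ?_
  rw [← omega_add_omega_compl b I, add_sub_cancel_left]
  exact (dominant_omega b _).mem_ratCone

/-- Moving the second of two weights to the dominant chamber does not enlarge the difference. -/
theorem sub_mem_hull_of_sub_smul_mem {x y z : L} (hx : Dominant b x) (hy : Dominant b y)
    (w : P.weylGroup) (h : x - w • y ∈ hull b z) : x - y ∈ hull b z := by
  generalize hn : len b w = n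
  induction n generalizing w with
  | zero => rwa [eq_one_of_len_eq_zero b hn, one_smul] at h
  | succ n ih =>
    obtain ⟨i, hi⟩ := exists_left_descent b (w := w) (by rintro rfl; simp at hn)
    have h1 := len_simpleRefl_mul_eq_or b w i
    refine ih (simpleRefl b i * w) ?_ (by omega)
    have h2 : ¬ b.IsPos (w⁻¹ • (i : ι)) := by
      rw [← len_mul_lt_iff, ← len_simpleRefl_mul, len_inv]; exact hi
    have h3 : P.toLinearMap (w • y) (P.coroot i) ≤ 0 := by
      rw [toLinearMap_smul_coroot]; exact hy.nonpos h2
    obtain ⟨p, hp⟩ := Int.eq_ofNat_of_zero_le (hx i)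
    obtain ⟨c, hc⟩ := Int.eq_ofNat_of_zero_le (neg_nonneg.mpr h3)
    have h4 : x - (simpleRefl b i * w) • y = (x - w • y) - c • P.root i := by
      rw [mul_smul, simpleRefl_smul, ← natCast_zsmul _ c, ← hc, neg_smul]; abel
    rw [h4]
    -- The new difference lies on the segment from x - w y to its reflection, dividing it in the
    -- ratio c : p. Both ends are in the hull, which is closed under rational convex combinations; p
    -- + c = 0 means that nothing moves.
    have h5 : simpleRefl b i • (x - w • y) = x - w • y - (p + c) • P.root i := by
      rw [simpleRefl_smul, map_sub, LinearMap.sub_apply, hp, sub_eq_add_neg (p : ℤ), hc,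
        ← Nat.cast_add, natCast_zsmul]
    rcases Nat.eq_zero_or_pos (p + c) with h6 | h6
    · have h7 : c = 0 := by omega
      rwa [h7, zero_smul, sub_zero]
    · intro v
      refine mem_ratCone_of_nsmul h6 ?_
      have h7 : (p + c) • (z - v • (x - w • y - c • P.root i)) =
          p • (z - v • (x - w • y)) + c • (z - v • (simpleRefl b i • (x - w • y))) := by
        rw [h5]
        simp only [smul_sub, smul_add, add_smul, smul_comm v (_ : ℕ)]
        simp only [← mul_smul, mul_comm c p]
        abel
      rw [h7]
      refine add_mem (nsmul_mem (h v) _) (nsmul_mem ?_ _)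
      rw [smul_smul]
      exact h _

/-! ### Stabilizers and parabolic subgroups -/

open Classical in
theorem mem_of_smul_omega_eq {I : Finset b.support} {w : P.weylGroup} {i : b.support}
    (h : w • omega b Iᶜ = omega b Iᶜ) (hi : len b (w * simpleRefl b i) < len b w) : i ∈ I := by
  by_contra h1
  have h2 := toLinearMap_smul_coroot_smul w (omega b Iᶜ) i
  rw [h, omega_coroot, if_pos (Finset.mem_compl.mpr h1)] at h2
  have := (dominant_omega b Iᶜ).nonpos ((len_mul_lt_iff b w i).mp hi)
  omega

theorem simpleRefl_mem_parabolic {I : Finset b.support} {i : b.support} (hi : i ∈ I) :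
    simpleRefl b i ∈ parabolic b I :=
  Subgroup.subset_closure ⟨i, hi, rfl⟩

open Classical in
theorem smul_omega_eq_iff {I : Finset b.support} {w : P.weylGroup} :
    w • omega b Iᶜ = omega b Iᶜ ↔ w ∈ parabolic b I := by
  have hs : ∀ i ∈ I, simpleRefl b i • omega b Iᶜ = omega b Iᶜ := by
    intro i hi
    rw [simpleRefl_smul, omega_coroot, if_neg (by simpa using hi), zero_smul, sub_zero]
  constructor
  · intro h
    generalize hn : len b w = n
    induction n generalizing w with
    | zero => rw [eq_one_of_len_eq_zero b hn]; exact one_mem _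
    | succ n ih =>
      obtain ⟨i, hi⟩ := exists_descent b (w := w) (by rintro rfl; simp at hn)
      have h1 := len_mul_eq_or b w i
      have h2 := mem_of_smul_omega_eq h hi
      have h3 := ih (w := w * simpleRefl b i) (by rw [mul_smul, hs i h2, h]) (by omega)
      have := mul_mem h3 (simpleRefl_mem_parabolic h2)
      rwa [mul_simpleRefl_cancel] at this
  · intro h
    induction h using Subgroup.closure_induction with
    | mem x hx =>
      obtain ⟨i, hi, rfl⟩ := hx
      exact hs i hi
    | one => exact one_smul _ _
    | mul x y _ _ hx hy => rw [mul_smul, hy, hx]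
    | inv x _ hx => rw [inv_smul_eq_iff, hx]

open Classical in
/-- An element without right descents in `I` is the shortest one of its coset of `W_I`. -/
theorem len_lt_len_mul {I : Finset b.support} {w x : P.weylGroup}
    (hw : ∀ i ∈ I, b.IsPos (w • (i : ι))) (hx : x • omega b Iᶜ = omega b Iᶜ) (h1 : x ≠ 1) :
    len b w < len b (w * x) := by
  generalize hn : len b x = n
  induction n generalizing x with
  | zero => exact absurd (eq_one_of_len_eq_zero b hn) h1
  | succ n ih =>
    obtain ⟨i, hi⟩ := exists_descent b h1
    have hl := len_mul_eq_or b x i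
    have hiI := mem_of_smul_omega_eq hx hi
    have h2 : (x * simpleRefl b i) • omega b Iᶜ = omega b Iᶜ := by
      rw [smul_omega_eq_iff] at hx ⊢
      exact mul_mem hx (simpleRefl_mem_parabolic hiI)
    set y := x * simpleRefl b i with hy
    have hxy : x = y * simpleRefl b i := by rw [hy, mul_simpleRefl_cancel]
    have h3 : b.IsPos (y • (i : ι)) := by
      by_contra h
      have := (len_mul_lt_iff b y i).mpr h
      rw [← hxy] at this
      omega
    have h4 : len b w ≤ len b (w * y) := by
      by_cases hy1 : y = 1
      · rw [hy1, mul_one]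
      · exact (ih h2 hy1 (by omega)).le
    -- y fixes ω of the complement of I, so the coroot of y α_i involves only simple coroots in I,
    -- and w keeps those positive.
    have h5 : b.IsPos ((w * y) • (i : ι)) := by
      obtain ⟨m, hm⟩ := exists_nat_coroot_eq b h3
      have h6 := toLinearMap_smul_coroot_smul y (omega b Iᶜ) i
      rw [h2, omega_coroot, if_neg (by simpa using hiI), hm, map_sum] at h6
      simp only [map_nsmul, omega_coroot] at h6
      rw [Finset.sum_eq_zero_iff_of_nonneg fun j _ => by positivity] at h6
      by_contra h7
      have h8 := (isPos_iff_rho_pos b _).not.mp h7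
      rw [mul_smul, ← inv_inv w, ← toLinearMap_smul_coroot, hm, map_sum, not_lt] at h8
      have h9 : ∀ j ∈ Finset.univ, 0 ≤ P.toLinearMap (w⁻¹ • rho b) (m j • P.coroot j) := by
        intro j hj
        have h10 := h6 j hj
        by_cases hj' : j ∈ I
        · rw [map_nsmul, toLinearMap_smul_coroot, inv_inv]
          exact nsmul_nonneg ((isPos_iff_rho_pos b _).mp (hw j hj')).le _
        · rw [if_pos (by simpa using hj')] at h10
          have : m j = 0 := by simpa using h10
          rw [this, zero_smul, map_zero]
      have h11 := le_antisymm h8 (Finset.sum_nonneg h9)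
      rw [Finset.sum_eq_zero_iff_of_nonneg h9] at h11
      apply P.flip.ne_zero (y • (i : ι))
      change P.coroot _ = 0
      rw [hm]
      refine Finset.sum_eq_zero fun j hj => ?_
      have h10 := h6 j hj
      by_cases hj' : j ∈ I
      · have h12 := h11 j hj
        rw [map_nsmul, toLinearMap_smul_coroot, inv_inv] at h12
        have h13 := (isPos_iff_rho_pos b _).mp (hw j hj')
        rw [(smul_eq_zero.mp h12).resolve_right h13.ne', zero_smul]
      · rw [if_pos (by simpa using hj')] at h10
        have : m j = 0 := by simpa using h10
        rw [this, zero_smul]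
    have := len_mul_simpleRefl_of_isPos b h5
    rw [hxy, ← mul_assoc]
    omega

end Weights

end

end KLS

namespace KLS

noncomputable section

variable {ι L L' : Type*} [AddCommGroup L] [AddCommGroup L'] {P : RootDatum ι L L'} (b : P.Base)

/-! ### Alternating sums in the group algebra -/

section GroupAlgebra

/-- The action of a Weyl group element on `ℂ[T]`, as a ring homomorphism. -/
def actHom (w : P.weylGroup) : CT L →+* CT L :=
  AddMonoidAlgebra.mapDomainRingHom ℂ (DistribSMul.toAddMonoidHom L w)

theorem act_eq_actHom (w : P.weylGroup) (f : CT L) : act w f = actHom w f := rfl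

@[simp]
theorem actHom_ex (w : P.weylGroup) (x : L) : actHom w (ex x) = ex (w • x) :=
  AddMonoidAlgebra.mapDomain_single

theorem actHom_mul (w v : P.weylGroup) (f : CT L) :
    actHom (w * v) f = actHom w (actHom v f) := by
  induction f using AddMonoidAlgebra.induction_linear with
  | zero => simp
  | add f g hf hg => simp only [map_add, hf, hg]
  | single x c =>
    change AddMonoidAlgebra.mapDomain _ _ =
      AddMonoidAlgebra.mapDomain _ (AddMonoidAlgebra.mapDomain _ _)
    rw [AddMonoidAlgebra.mapDomain_single, AddMonoidAlgebra.mapDomain_single,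
      AddMonoidAlgebra.mapDomain_single]
    exact congrArg (AddMonoidAlgebra.single · c) (mul_smul w v x)

@[simp]
theorem actHom_one (f : CT L) : actHom (1 : P.weylGroup) f = f := by
  induction f using AddMonoidAlgebra.induction_linear with
  | zero => simp
  | add f g hf hg => simp only [map_add, hf, hg]
  | single x c =>
    change AddMonoidAlgebra.mapDomain _ _ = _
    rw [AddMonoidAlgebra.mapDomain_single]
    exact congrArg (AddMonoidAlgebra.single · c) (one_smul _ x)

theorem ex_mul_ex (x y : L) : (ex x : CT L) * ex y = ex (x + y) := by
  simp [ex, AddMonoidAlgebra.single_mul_single]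

variable [Finite ι] [P.IsReduced] [IsSimplyConnected P] [Module.Free ℤ L]

/-- `∑_w sgn(w) w(f)`, as an additive homomorphism. -/
def antisymHom : CT L →+ CT L where
  toFun := antisym b
  map_zero' := by simp [antisym, act_eq_actHom]
  map_add' f g := by simp [antisym, act_eq_actHom, smul_add, Finset.sum_add_distrib]

theorem antisym_apply (f : CT L) : antisym b f = ∑ w : P.weylGroup, sgn b w • actHom w f := rfl

theorem antisym_zero : antisym b (0 : CT L) = 0 := (antisymHom b).map_zero

theorem antisym_add (f g : CT L) : antisym b (f + g) = antisym b f + antisym b g :=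
  (antisymHom b).map_add f g

theorem antisym_sub (f g : CT L) : antisym b (f - g) = antisym b f - antisym b g :=
  (antisymHom b).map_sub f g

theorem antisym_neg (f : CT L) : antisym b (-f) = -antisym b f :=
  (antisymHom b).map_neg f

theorem antisym_zsmul (n : ℤ) (f : CT L) : antisym b (n • f) = n • antisym b f :=
  (antisymHom b).map_zsmul n f

theorem antisym_sum {α : Type*} (s : Finset α) (f : α → CT L) :
    antisym b (∑ i ∈ s, f i) = ∑ i ∈ s, antisym b (f i) :=
  map_sum (antisymHom b) f s

theorem antisym_actHom (w : P.weylGroup) (f : CT L) :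
    antisym b (actHom w f) = sgn b w • antisym b f := by
  rw [antisym_apply, antisym_apply, Finset.smul_sum]
  refine Fintype.sum_equiv (Equiv.mulRight w) _ _ fun v => ?_
  rw [Equiv.coe_mulRight, actHom_mul, smul_smul, sgn_mul, mul_left_comm, sgn_mul_self, mul_one]

variable (P) in
/-- The subring of Weyl group invariants in `ℂ[T]`. -/
def invariants : Subring (CT L) := ⨅ w : P.weylGroup, (actHom w).eqLocus (RingHom.id _)

theorem mem_invariants {f : CT L} : f ∈ invariants P ↔ ∀ w : P.weylGroup, actHom w f = f := by
  simp [invariants, Subring.mem_iInf, RingHom.mem_eqLocus]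

theorem antisym_mul_of_mem {f r : CT L} (hr : r ∈ invariants P) :
    antisym b (f * r) = antisym b f * r := by
  rw [mem_invariants] at hr
  rw [antisym_apply, antisym_apply, Finset.sum_mul]
  exact Finset.sum_congr rfl fun w _ => by rw [map_mul, hr, smul_mul_assoc]

theorem antisym_ex_smul (w : P.weylGroup) (x : L) :
    antisym b (ex (w • x)) = sgn b w • antisym b (ex x) := by
  rw [← actHom_ex, antisym_actHom]

theorem antisym_ex_eq (w : P.weylGroup) (x : L) :
    antisym b (ex x) = sgn b w • antisym b (ex (w • x)) := by
  rw [antisym_ex_smul, smul_smul, sgn_mul_self, one_smul]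

variable {b} in
/-- The alternating sum of a dominant weight vanishes unless the weight is regular. -/
theorem Dominant.sub_rho {x : L} (hx : Dominant b x) (h : antisym b (ex x) ≠ 0) :
    Dominant b (x - rho b) := by
  intro i
  rw [map_sub, LinearMap.sub_apply, rho_coroot]
  have h1 := hx i
  by_contra h2
  have h3 : P.toLinearMap x (P.coroot i) = 0 := by omega
  have h4 := antisym_ex_smul b (simpleRefl b i) x
  rw [simpleRefl_smul, h3, zero_smul, sub_zero, sgn_simpleRefl, neg_one_smul] at h4
  apply h
  ext z
  have h5 := congrArg (fun f : CT L => f.coeff z) h4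
  exact self_eq_neg.mp h5

variable {b} in
theorem eq_one_of_smul_rho_eq {w : P.weylGroup} (h : w • rho b = rho b) : w = 1 := by
  apply eq_one_of_forall_isPos b
  intro i
  have h1 := toLinearMap_smul_coroot_smul w (rho b) i
  rw [h, rho_coroot] at h1
  rw [isPos_iff_rho_pos, h1]
  exact one_pos

/-- The stabilizer of ρ is trivial, so exp(ρ) occurs in δ with coefficient 1. -/
theorem denom_ne_zero : denom b ≠ 0 := by
  classical
  intro h
  have h1 : (denom b).coeff (rho b) = 1 := by
    rw [denom, antisym_apply, AddMonoidAlgebra.coeff_sum, Finsupp.finsetSum_apply,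
      Finset.sum_eq_single 1]
    · simp [ex]
    · intro w _ hw
      rw [actHom_ex, AddMonoidAlgebra.coeff_smul_apply, ex, AddMonoidAlgebra.coeff_single,
        Finsupp.single_apply, if_neg fun h => hw (eq_one_of_smul_rho_eq h), smul_zero]
    · simp
  rw [h] at h1
  simp at h1

theorem denom_eq : denom b = antisym b (ex (rho b)) := rfl

/-- The elements of `ℤ[X]` supported on the hull of a weight. -/
def hullSpan (y : L) : AddSubgroup (CT L) := AddSubgroup.closure (ex '' hull b y)

variable {b}

theorem ex_mem_hullSpan {y z : L} (h : z ∈ hull b y) : ex z ∈ hullSpan b y :=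
  AddSubgroup.subset_closure ⟨z, h, rfl⟩

theorem hullSpan_mono {x y : L} (h : y - x ∈ ratCone b) : hullSpan b x ≤ hullSpan b y :=
  AddSubgroup.closure_mono (Set.image_mono (hull_mono h))

theorem mul_mem_hullSpan {y z : L} {f g : CT L} (hf : f ∈ hullSpan b y) (hg : g ∈ hullSpan b z) :
    f * g ∈ hullSpan b (y + z) := by
  induction hf using AddSubgroup.closure_induction with
  | zero => rw [zero_mul]; exact zero_mem _
  | add f f' _ _ hf hf' => rw [add_mul]; exact add_mem hf hf'
  | neg f _ hf => rw [neg_mul]; exact neg_mem hf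
  | mem f hf =>
    obtain ⟨x, hx, rfl⟩ := hf
    induction hg using AddSubgroup.closure_induction with
    | zero => rw [mul_zero]; exact zero_mem _
    | add f f' _ _ hf hf' => rw [mul_add]; exact add_mem hf hf'
    | neg f _ hf => rw [mul_neg]; exact neg_mem hf
    | mem f hf =>
      obtain ⟨x', hx', rfl⟩ := hf
      rw [ex_mul_ex]
      exact ex_mem_hullSpan (add_mem_hull hx hx')

theorem mem_ratCone_of_hullSpan_ne_zero {y : L} {f : CT L} (hf : f ∈ hullSpan b y) (h : f ≠ 0) :
    y ∈ ratCone b := by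
  by_contra hy
  have : hull b y = ∅ := Set.eq_empty_of_forall_notMem fun z hz => hy (mem_ratCone_of_mem_hull hz)
  rw [hullSpan, this, Set.image_empty, AddSubgroup.closure_empty, AddSubgroup.mem_bot] at hf
  exact h hf

variable (b) in
/-- The multiples of the Weyl denominator by invariant elements of `ℤ[X]` supported on the hull
of a weight. -/
def denomMultiples (y : L) : AddSubgroup (CT L) :=
  (hullSpan b y ⊓ (invariants P).toAddSubgroup).map (AddMonoidHom.mulRight (denom b))

theorem mem_denomMultiples {y : L} {f : CT L} : f ∈ denomMultiples b y ↔
    ∃ r ∈ hullSpan b y, r ∈ invariants P ∧ r * denom b = f := by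
  simp [denomMultiples, AddSubgroup.mem_map, and_assoc]

theorem denomMultiples_mono {x y : L} (h : y - x ∈ ratCone b) :
    denomMultiples b x ≤ denomMultiples b y :=
  AddSubgroup.map_mono (inf_le_inf_right _ (hullSpan_mono h))

theorem Dominant.card_nsmul_mem {x : L} (hx : Dominant b x) :
    Fintype.card P.weylGroup • x ∈ simpleCone b := by
  have h1 : ∑ w : P.weylGroup, (x - w • x) = Fintype.card P.weylGroup • x := by
    rw [Finset.sum_sub_distrib, sum_smul_eq_zero b, sub_zero, Finset.sum_const, Finset.card_univ]
  rw [← h1]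
  exact sum_mem fun w _ => hx.sub_smul_mem w

/-- |W| x is a natural combination of simple roots, and the sum of its coefficients strictly
decreases on passing to a smaller dominant weight. -/
theorem dominant_induction {p : L → Prop}
    (h : ∀ x, Dominant b x → (∀ y, Dominant b y → x - y ∈ simpleCone b → y ≠ x → p y) → p x)
    {x : L} (hx : Dominant b x) : p x := by
  obtain ⟨c, hc⟩ := exists_nat_of_mem_simpleCone hx.card_nsmul_mem
  generalize hn : ∑ i, c i = n
  induction n using Nat.strong_induction_on generalizing x c with
  | h n ih =>
  refine h x hx fun y hy hxy hne => ?_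
  obtain ⟨d, hd⟩ := exists_nat_of_mem_simpleCone hy.card_nsmul_mem
  obtain ⟨e, he⟩ := exists_nat_of_mem_simpleCone hxy
  set N := Fintype.card P.weylGroup with hN
  have hN0 : 0 < N := Fintype.card_pos
  refine ih (∑ i, d i) ?_ hy d hd rfl
  have h1 : ∑ i : b.support, ((c i : ℤ) - (d i + N * e i)) • P.root i = 0 := by
    simp only [sub_smul, add_smul, mul_smul, natCast_zsmul]
    rw [Finset.sum_sub_distrib, Finset.sum_add_distrib, ← Finset.smul_sum, ← hc, ← hd, ← he,
      smul_sub]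
    abel
  have h2 := Fintype.linearIndependent_iff.mp
    (show LinearIndependent ℤ fun i : b.support => P.root i from b.linearIndepOn_root) _ h1
  have h3 : ∀ i, c i = d i + N * e i := fun i => by have := h2 i; zify; omega
  rw [← hn]
  simp only [h3]
  rw [Finset.sum_add_distrib, ← Finset.mul_sum]
  have h4 : ∑ i, e i ≠ 0 := by
    intro h4
    rw [Finset.sum_eq_zero_iff] at h4
    apply hne
    rw [eq_comm, ← sub_eq_zero, he]
    exact Finset.sum_eq_zero fun i hi => by rw [h4 i hi, zero_smul]
  have := Nat.mul_pos hN0 (Nat.pos_of_ne_zero h4)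
  omega

/-- The alternating sum of a dominant regular weight is a multiple of the Weyl denominator. -/
theorem antisym_ex_add_rho_mem {x : L} (hx : Dominant b x) :
    antisym b (ex (x + rho b)) ∈ denomMultiples b x := by
  classical
  refine dominant_induction (b := b)
    (p := fun x => antisym b (ex (x + rho b)) ∈ denomMultiples b x) ?_ hx
  clear hx x
  intro x hx ih
  set O := Finset.univ.image fun w : P.weylGroup => w • x with hO
  have hxO : x ∈ O := Finset.mem_image.mpr ⟨1, Finset.mem_univ _, one_smul _ _⟩
  have hm : ∑ z ∈ O, ex z ∈ invariants P := by
    rw [mem_invariants]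
    intro w
    rw [map_sum]
    simp only [actHom_ex]
    refine Finset.sum_bij (fun z _ => w • z) ?_ ?_ ?_ ?_
    · intro z hz
      obtain ⟨v, -, rfl⟩ := Finset.mem_image.mp hz
      exact Finset.mem_image.mpr ⟨w * v, Finset.mem_univ _, mul_smul _ _ _⟩
    · intro z _ z' _ h
      exact smul_left_cancel w h
    · intro z hz
      obtain ⟨v, -, rfl⟩ := Finset.mem_image.mp hz
      exact ⟨w⁻¹ • v • x, Finset.mem_image.mpr ⟨w⁻¹ * v, Finset.mem_univ _, mul_smul _ _ _⟩,
        smul_inv_smul _ _⟩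
    · intros; rfl
  have hm' : ∑ z ∈ O, ex z ∈ hullSpan b x := by
    refine sum_mem fun z hz => ?_
    obtain ⟨v, -, rfl⟩ := Finset.mem_image.mp hz
    exact ex_mem_hullSpan (smul_mem_hull hx.mem_hull v)
  -- The invariant orbit sum times δ is the wanted alternating sum plus those of z + ρ for the other
  -- z in the orbit. These vanish or are conjugate to y + ρ with y dominant and smaller than x.
  have h1 : (∑ z ∈ O, ex z) * denom b = ∑ z ∈ O, antisym b (ex (z + rho b)) := by
    rw [mul_comm, denom_eq, ← antisym_mul_of_mem b hm, Finset.mul_sum, antisym_sum]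
    exact Finset.sum_congr rfl fun z _ => by rw [ex_mul_ex, add_comm]
  rw [← Finset.add_sum_erase O (fun z => antisym b (ex (z + rho b))) hxO,
    ← sub_eq_iff_eq_add] at h1
  rw [← h1]
  refine sub_mem (mem_denomMultiples.mpr ⟨_, hm', hm, rfl⟩) (sum_mem fun z hz => ?_)
  obtain ⟨hne, hz⟩ := Finset.mem_erase.mp hz
  obtain ⟨v, -, rfl⟩ := Finset.mem_image.mp hz
  obtain ⟨u, hu⟩ := exists_dominant_smul b (v • x + rho b)
  by_cases h0 : antisym b (ex (u • (v • x + rho b))) = 0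
  · rw [antisym_ex_eq b u, h0, smul_zero]; exact zero_mem _
  have hd := hu.sub_rho h0
  set y := u • (v • x + rho b) - rho b with hy
  have e1 : u • (v • x + rho b) = y + rho b := by rw [hy, sub_add_cancel]
  have hxv : x - (u * v) • x ∈ simpleCone b := hx.sub_smul_mem _
  have hρ : rho b - u • rho b ∈ simpleCone b := (dominant_rho b).sub_smul_mem u
  have e2 : x - y = (x - (u * v) • x) + (rho b - u • rho b) := by
    rw [hy, smul_add, mul_smul]; abel
  have hxy : x - y ∈ simpleCone b := by rw [e2]; exact add_mem hxv hρ
  -- Equality would make both summands of x - y zero; the second then forces u = 1, and the first v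
  -- x = x, which was removed from the orbit.
  have hyx : y ≠ x := by
    intro h
    rw [h, sub_self] at e2
    have h3 : rho b - u • rho b = 0 := eq_zero_of_mem_simpleCone hρ (by
      rw [← eq_neg_of_add_eq_zero_left e2.symm]; exact hxv)
    have h4 := eq_one_of_smul_rho_eq (sub_eq_zero.mp h3).symm
    rw [h3, add_zero, h4, one_mul] at e2
    exact hne (sub_eq_zero.mp e2.symm).symm
  rw [antisym_ex_eq b u, e1]
  exact zsmul_mem (denomMultiples_mono (mem_ratCone_of_mem hxy) (ih y hd hxy hyx)) _

/-- A nonzero alternating sum belongs to a regular weight, whose dominant conjugate has the form x +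
ρ with x dominant. The hull condition gives x ≤ y. -/
theorem antisym_ex_mem {y z : L} (hz : z ∈ hull b (y + rho b)) :
    antisym b (ex z) ∈ denomMultiples b y := by
  obtain ⟨u, hu⟩ := exists_dominant_smul b z
  rw [antisym_ex_eq b u]
  refine zsmul_mem ?_ _
  by_cases h0 : antisym b (ex (u • z)) = 0
  · rw [h0]; exact zero_mem _
  have hd := hu.sub_rho h0
  have h1 := antisym_ex_add_rho_mem hd
  rw [sub_add_cancel] at h1
  refine denomMultiples_mono ?_ h1
  have := hz u
  rwa [sub_sub_eq_add_sub]

theorem antisym_mem {y : L} {f : CT L} (hf : f ∈ hullSpan b (y + rho b)) :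
    antisym b f ∈ denomMultiples b y := by
  induction hf using AddSubgroup.closure_induction with
  | zero => rw [antisym_zero]; exact zero_mem _
  | add f f' _ _ hf hf' => rw [antisym_add]; exact add_mem hf hf'
  | neg f _ hf => rw [antisym_neg]; exact neg_mem hf
  | mem f hf =>
    obtain ⟨x, hx, rfl⟩ := hf
    exact antisym_ex_mem hx

end GroupAlgebra

end

end KLS

namespace KLS

noncomputable section

variable {ι L L' : Type*} [AddCommGroup L] [AddCommGroup L'] {P : RootDatum ι L L'} {b : P.Base}

/-! ### The Kazhdan-Lusztig-Steinberg basis and its dual -/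

section Basis

theorem sum_eq_card_smul_sum_out {G M : Type*} [Group G] [Fintype G] [AddCommMonoid M]
    (H : Subgroup G) [Fintype (G ⧸ H)] (F : G → M) (hF : ∀ g, ∀ h ∈ H, F (g * h) = F g) :
    ∑ g, F g = Nat.card H • ∑ c : G ⧸ H, F c.out := by
  classical
  have : Fintype H := Fintype.ofFinite _
  have h1 : ∀ g : G, F g = F ((g : G ⧸ H)).out := by
    intro g
    obtain ⟨h, hh⟩ := QuotientGroup.mk_out_eq_mul H g
    rw [hh, hF g h h.2]
  rw [Fintype.sum_equiv Subgroup.groupEquivQuotientProdSubgroup F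
    (fun p : (G ⧸ H) × H => F p.1.out) fun g => h1 g, Fintype.sum_prod_type]
  simp only [Finset.sum_const, Finset.card_univ]
  rw [Finset.smul_sum, Nat.card_eq_fintype_card]

variable [Finite ι] [P.IsReduced] [IsSimplyConnected P] [Module.Free ℤ L]

theorem klP_mul_of_mem {v x : P.weylGroup} (hx : x ∈ parabolic b (rightDescent b v))
    (y : P.weylGroup) : klP b (y * x) v = klP b y v := by
  induction hx using Subgroup.closure_induction generalizing y with
  | mem x hx =>
    obtain ⟨i, hi, rfl⟩ := hx
    exact klP_mul_simpleRefl b ((mem_rightDescent_iff b).mp hi) y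
  | one => rw [mul_one]
  | mul x x' _ _ hx hx' => rw [← mul_assoc, hx', hx]
  | inv x _ hx => rw [← hx (y * x⁻¹), inv_mul_cancel_right]

open Classical in
/-- The expansion of `f_v` into exponentials of distinct weights. -/
theorem fKLS_eq (v : P.weylGroup) [Fintype (P.weylGroup ⧸ parabolic b (rightDescent b v))] :
    fKLS b v = ∑ c : P.weylGroup ⧸ parabolic b (rightDescent b v),
      (klP b c.out v).eval 1 • ex (c.out • omega b (rightDescent b v)ᶜ) := by
  unfold fKLS klAct
  -- The summand is constant on cosets of W_{I(v)}, so the normalizing factor cancels and the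
  -- coefficients become integers.
  rw [sum_eq_card_smul_sum_out (parabolic b (rightDescent b v))]
  · simp only [act_eq_actHom, actHom_ex]
    rw [← Nat.cast_smul_eq_nsmul ℂ, smul_smul, inv_mul_cancel₀, one_smul]
    exact Nat.cast_ne_zero.mpr Nat.card_pos.ne'
  · intro y x hx
    rw [klP_mul_of_mem hx, act_eq_actHom, act_eq_actHom, actHom_ex, actHom_ex, mul_smul,
      smul_omega_eq_iff.mpr hx]

open Classical in
theorem fKLS_mem_hullSpan (v : P.weylGroup) :
    fKLS b v ∈ hullSpan b (omega b (rightDescent b v)ᶜ) := by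
  have : Fintype (P.weylGroup ⧸ parabolic b (rightDescent b v)) := Fintype.ofFinite _
  rw [fKLS_eq]
  exact sum_mem fun c _ => zsmul_mem
    (ex_mem_hullSpan (smul_mem_hull (dominant_omega b _).mem_hull _)) _

-- Regularity makes the dominant conjugate at least ρ, but conjugates of ω_I and of the
-- complementary sum add up to at most ρ. So equality holds in both parts, and one Weyl element
-- moves both at once.
open Classical in
theorem exists_smul_omega_eq {I : Finset b.support} {y z : P.weylGroup}
    (h : antisym b (ex (y • omega b Iᶜ + z • omega b I)) ≠ 0) :
    ∃ u : P.weylGroup, u • omega b Iᶜ = y • omega b Iᶜ ∧ u • omega b I = z • omega b I := by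
  obtain ⟨t, ht⟩ := exists_dominant_smul b (y • omega b Iᶜ + z • omega b I)
  have h1 := (ht.sub_rho fun h0 => h (by rw [antisym_ex_eq b t, h0, smul_zero])).mem_ratCone
  have h2 : ∀ (J : Finset b.support) (v : P.weylGroup), omega b J - v • omega b J ∈ ratCone b :=
    fun J v => mem_ratCone_of_mem ((dominant_omega b J).sub_smul_mem v)
  have h3 := h2 Iᶜ (t * y)
  have h4 := h2 I (t * z)
  have h5 : -((omega b Iᶜ - (t * y) • omega b Iᶜ) + (omega b I - (t * z) • omega b I)) ∈
      ratCone b := by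
    convert! h1 using 1
    rw [← omega_add_omega_compl b I, smul_add, mul_smul, mul_smul]
    abel
  have h6 := eq_zero_of_mem_ratCone (add_mem h3 h4) h5
  have h7 : omega b Iᶜ - (t * y) • omega b Iᶜ = 0 :=
    eq_zero_of_mem_ratCone h3 (by rwa [← eq_neg_of_add_eq_zero_right h6])
  rw [h7, zero_add] at h6
  refine ⟨t⁻¹, ?_, ?_⟩
  · rw [inv_smul_eq_iff, smul_smul]; exact sub_eq_zero.mp h7
  · rw [inv_smul_eq_iff, smul_smul]; exact sub_eq_zero.mp h6

-- The element u of `exists_smul_omega_eq` lies in y W_{I(v)}, so P_{u,v} = P_{y,v} ≠ 0 gives u = v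
-- or ℓ(u) < ℓ(v). It also lies in w W_J with J the complement of I(w), where w is the shortest
-- element.
open Classical in
theorem eq_or_lt_of_antisym_ne_zero {v w y : P.weylGroup} (hI : rightDescent b v = rightDescent b w)
    (hP : klP b y v ≠ 0) (h : antisym b
      (ex (y • omega b (rightDescent b v)ᶜ + w • omega b (rightDescent b w))) ≠ 0) :
    len b w < len b v ∨ v = w ∧ y⁻¹ * w ∈ parabolic b (rightDescent b w) := by
  rw [← hI] at h
  obtain ⟨u, hu, hu'⟩ := exists_smul_omega_eq h
  have h1 : y⁻¹ * u ∈ parabolic b (rightDescent b v) := by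
    rw [← smul_omega_eq_iff, mul_smul, hu, inv_smul_smul]
  have h2 : klP b u v ≠ 0 := by
    rwa [← klP_mul_of_mem h1, mul_inv_cancel_left] at hP
  have h3 : u = v ∨ len b u < len b v := by
    by_contra h
    push Not at h
    exact h2 (klP_eq_zero b h.1 h.2)
  have h4 : u = w ∨ len b w < len b u := by
    by_cases h5 : w⁻¹ * u = 1
    · exact Or.inl (inv_mul_eq_one.mp h5).symm
    · right
      have := len_lt_len_mul (I := (rightDescent b v)ᶜ) (w := w) (x := w⁻¹ * u) (fun i hi => by
        rw [hI, Finset.mem_compl, mem_rightDescent, not_not] at hi; exact hi)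
        (by rw [compl_compl, mul_smul, hu', inv_smul_smul]) h5
      rwa [mul_inv_cancel_left] at this
  rcases h3 with h3 | h3 <;> rcases h4 with h4 | h4
  · right
    refine ⟨h3 ▸ h4, ?_⟩
    rw [← hI, ← h4]
    exact h1
  · left; rwa [← h3]
  · left; rwa [← h4]
  · left; omega

open Classical in
theorem antisym_fKLS_mul_eq_zero {v w : P.weylGroup} (hI : rightDescent b v = rightDescent b w)
    (hvw : v ≠ w) (h : len b v ≤ len b w) :
    antisym b (fKLS b v * ex (w • omega b (rightDescent b w))) = 0 := by
  have : Fintype (P.weylGroup ⧸ parabolic b (rightDescent b v)) := Fintype.ofFinite _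
  rw [fKLS_eq, Finset.sum_mul, antisym_sum]
  refine Finset.sum_eq_zero fun c _ => ?_
  rw [smul_mul_assoc, ex_mul_ex, antisym_zsmul]
  by_contra h1
  rcases eq_or_lt_of_antisym_ne_zero hI (y := c.out) (fun h2 => h1 (by rw [h2]; simp))
    (fun h2 => h1 (by rw [h2, smul_zero])) with h3 | h3
  · omega
  · exact hvw h3.1

/-- Only the coset of w contributes. Its coefficient is P_{w,w}(1) = 1 and its exponent is w ρ. -/
theorem antisym_fKLS_mul_self (w : P.weylGroup) :
    antisym b (fKLS b w * ex (w • omega b (rightDescent b w))) = sgn b w • denom b := by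
  classical
  have : Fintype (P.weylGroup ⧸ parabolic b (rightDescent b w)) := Fintype.ofFinite _
  rw [fKLS_eq, Finset.sum_mul, antisym_sum, Finset.sum_eq_single (w : P.weylGroup ⧸ _)]
  · rw [smul_mul_assoc, ex_mul_ex, antisym_zsmul]
    obtain ⟨x, hx⟩ := QuotientGroup.mk_out_eq_mul (parabolic b (rightDescent b w)) w
    rw [hx, klP_mul_of_mem x.2, klP_self, Polynomial.eval_one, one_smul, mul_smul,
      smul_omega_eq_iff.mpr x.2, ← smul_add, add_comm, omega_add_omega_compl, antisym_ex_smul]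
    rfl
  · intro c _ hc
    rw [smul_mul_assoc, ex_mul_ex, antisym_zsmul]
    by_contra h1
    rcases eq_or_lt_of_antisym_ne_zero rfl (y := c.out) (fun h2 => h1 (by rw [h2]; simp))
      (fun h2 => h1 (by rw [h2, smul_zero])) with h3 | h3
    · exact lt_irrefl _ h3
    · apply hc
      rw [← QuotientGroup.out_eq' c]
      exact QuotientGroup.eq.mpr h3.2
  · simp

variable (b) in
/-- The order in which the dual basis is constructed. -/
def GramLT (v w : P.weylGroup) : Prop :=
  (omega b (rightDescent b w) - omega b (rightDescent b v) ∈ ratCone b ∧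
    rightDescent b v ≠ rightDescent b w) ∨
  (rightDescent b v = rightDescent b w ∧ len b w < len b v)

theorem wellFounded_gramLT : WellFounded (GramLT b) := by
  have : IsTrans _ (GramLT b) := by
    refine ⟨fun u v w h h' => ?_⟩
    rcases h with ⟨h, hn⟩ | ⟨h, hn⟩ <;> rcases h' with ⟨h', hn'⟩ | ⟨h', hn'⟩
    · refine Or.inl ⟨?_, fun h3 => hn ?_⟩
      · have := add_mem h' h
        rwa [sub_add_sub_cancel] at this
      · exact omega_injective b (eq_of_sub_mem_ratCone (by rw [h3]; exact h') h)
    · exact Or.inl (by rw [← h']; exact ⟨h, hn⟩)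
    · exact Or.inl (by rw [h]; exact ⟨h', hn'⟩)
    · exact Or.inr ⟨h.trans h', hn'.trans hn⟩
  have : Std.Irrefl (GramLT b) :=
    ⟨fun w h => h.elim (fun h => h.2 rfl) fun h => lt_irrefl _ h.2⟩
  exact Finite.wellFounded_of_trans_of_irrefl _

-- The product is supported on the hull of ω_{I(w)} plus the complementary sum ρ - ω_{I(v)};
-- division by δ costs ρ. If the resulting bound is not in the cone, the alternating sum is zero.
open Classical in
theorem antisym_fKLS_mul_mem (v : P.weylGroup) {w : P.weylGroup} {g : CT L}
    (hg : g ∈ hullSpan b (omega b (rightDescent b w))) :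
    antisym b (fKLS b v * g) ∈
      denomMultiples b (omega b (rightDescent b w) - omega b (rightDescent b v)) := by
  apply antisym_mem
  have h := mul_mem_hullSpan (fKLS_mem_hullSpan v) hg
  convert! h using 2
  rw [← omega_add_omega_compl b (rightDescent b v)]
  abel

theorem antisym_fKLS_mul_eq_zero_of_not_gramLT {v w : P.weylGroup} (hvw : v ≠ w)
    (h : ¬ GramLT b v w) : antisym b (fKLS b v * ex (w • omega b (rightDescent b w))) = 0 := by
  by_cases hI : rightDescent b v = rightDescent b w
  · refine antisym_fKLS_mul_eq_zero hI hvw ?_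
    by_contra h1
    exact h (Or.inr ⟨hI, not_le.mp h1⟩)
  · obtain ⟨r, hr, -, hr'⟩ := mem_denomMultiples.mp (antisym_fKLS_mul_mem (b := b) v
      (ex_mem_hullSpan (smul_mem_hull (dominant_omega b (rightDescent b w)).mem_hull w)))
    rw [← hr']
    by_contra h1
    exact h (Or.inl ⟨mem_ratCone_of_hullSpan_ne_zero hr (left_ne_zero_of_mul h1), hI⟩)

open Classical in
/-- The existence of the dual basis, with integral elements of controlled support. -/
theorem exists_dual (w : P.weylGroup) : ∃ h ∈ hullSpan b (omega b (rightDescent b w)),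
    ∀ v, antisym b (fKLS b v * h) = if v = w then denom b else 0 := by
  induction w using wellFounded_gramLT (b := b).induction with
  | h w ih =>
  have hg : ex (w • omega b (rightDescent b w)) ∈ hullSpan b (omega b (rightDescent b w)) :=
    ex_mem_hullSpan (smul_mem_hull (dominant_omega b _).mem_hull w)
  have hG := fun v => mem_denomMultiples.mp (antisym_fKLS_mul_mem (b := b) v (zsmul_mem hg (sgn b w)))
  choose G hG hG' hG'' using hG
  have ih' : ∀ v, ∃ h : CT L, GramLT b v w → h ∈ hullSpan b (omega b (rightDescent b v)) ∧
      ∀ u, antisym b (fKLS b u * h) = if u = v then denom b else 0 := by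
    intro v
    by_cases hv : GramLT b v w
    · obtain ⟨h, h1, h2⟩ := ih v hv
      exact ⟨h, fun _ => ⟨h1, h2⟩⟩
    · exact ⟨0, fun h => absurd h hv⟩
  choose h hh using ih'
  -- One elimination step: G v is the pairing of f_v with the signed exponential and is invariant,
  -- so h v * G v corrects only the pairing with f_v. The bounds ω_{I(v)} and ω_{I(w)} - ω_{I(v)}
  -- add up to the one required.
  refine ⟨sgn b w • ex (w • omega b (rightDescent b w)) -
    ∑ v ∈ Finset.univ.filter (fun v => GramLT b v w), h v * G v, ?_, fun u => ?_⟩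
  · refine sub_mem (zsmul_mem hg _) (sum_mem fun v hv => ?_)
    have h1 := mul_mem_hullSpan (hh v (Finset.mem_filter.mp hv).2).1 (hG v)
    rwa [add_sub_cancel] at h1
  · rw [mul_sub, antisym_sub, Finset.mul_sum, antisym_sum]
    have h1 : ∀ v ∈ Finset.univ.filter (fun v => GramLT b v w),
        antisym b (fKLS b u * (h v * G v)) = if u = v then denom b * G v else 0 := by
      intro v hv
      rw [← mul_assoc, antisym_mul_of_mem b (hG' v), (hh v (Finset.mem_filter.mp hv).2).2 u]
      split_ifs
      · rfl
      · rw [zero_mul]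
    rw [Finset.sum_congr rfl h1, Finset.sum_ite_eq]
    have hmem : u ∈ Finset.univ.filter (fun v => GramLT b v w) ↔ GramLT b u w := by simp
    by_cases hu : GramLT b u w
    · have hne : u ≠ w := by
        rintro rfl
        exact wellFounded_gramLT.irrefl.irrefl _ hu
      rw [if_pos (hmem.mpr hu), if_neg hne, ← hG'' u, mul_comm,
        sub_self]
    · rw [if_neg (fun h => hu (hmem.mp h)), sub_zero, mul_smul_comm, antisym_zsmul]
      by_cases hne : u = w
      · rw [if_pos hne, hne, antisym_fKLS_mul_self, smul_smul, sgn_mul_self, one_smul]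
      · rw [if_neg hne, antisym_fKLS_mul_eq_zero_of_not_gramLT hne hu, smul_zero]

/-! ### Clearing denominators; uniqueness of the dual basis -/

theorem algebraMap_denom_ne_zero : algebraMap (CT L) (FractionRing (CT L)) (denom b) ≠ 0 := by
  rw [Ne, FaithfulSMul.algebraMap_eq_zero_iff]
  exact denom_ne_zero b

theorem pairing_eq_zero_iff {f g : CT L} : pairing b f g = 0 ↔ antisym b (f * g) = 0 := by
  rw [pairing, div_eq_zero_iff, or_iff_left algebraMap_denom_ne_zero,
    FaithfulSMul.algebraMap_eq_zero_iff]

theorem pairing_eq_one_iff {f g : CT L} : pairing b f g = 1 ↔ antisym b (f * g) = denom b := by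
  rw [pairing, div_eq_one_iff_eq algebraMap_denom_ne_zero]
  exact (FaithfulSMul.algebraMap_injective _ _).eq_iff

open Classical in
theorem isDualKLS_iff {g : P.weylGroup → CT L} : IsDualKLS b g ↔
    ∀ v w, antisym b (fKLS b v * g w) = if v = w then denom b else 0 := by
  refine forall_congr' fun v => forall_congr' fun w => ?_
  split_ifs
  · exact pairing_eq_one_iff
  · exact pairing_eq_zero_iff

variable (b) in
theorem exists_isDualKLS : ∃ g : P.weylGroup → CT L, IsDualKLS b g ∧
    ∀ w, g w ∈ hullSpan b (omega b (rightDescent b w)) := by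
  choose g hg hg' using exists_dual (b := b)
  exact ⟨g, isDualKLS_iff.mpr fun v w => hg' w v, hg⟩

/-- The pairing with the elements `f_v` is nondegenerate. -/
theorem eq_zero_of_forall_antisym_fKLS_mul {h : CT L} (hh : ∀ v, antisym b (fKLS b v * h) = 0) :
    h = 0 := by
  classical
  obtain ⟨g, hg, -⟩ := exists_isDualKLS b
  rw [isDualKLS_iff] at hg
  -- Duality says that A * B is δ times the identity, so A is nonsingular. The hypothesis puts the
  -- vector of signed conjugates of h in the kernel of A, and its entry at 1 is h.
  let A : Matrix P.weylGroup P.weylGroup (CT L) := fun v u => actHom u (fKLS b v)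
  let B : Matrix P.weylGroup P.weylGroup (CT L) := fun u w => sgn b u • actHom u (g w)
  have hAB : A * B = denom b • (1 : Matrix P.weylGroup P.weylGroup (CT L)) := by
    ext1 v w
    rw [Matrix.smul_apply, Matrix.one_apply, smul_eq_mul, mul_ite, mul_one, mul_zero, ← hg v w,
      Matrix.mul_apply, antisym_apply]
    exact Finset.sum_congr rfl fun u _ => by rw [map_mul, mul_smul_comm]
  have hA : A.det ≠ 0 := by
    have h1 := congrArg Matrix.det hAB
    rw [Matrix.det_mul, Matrix.det_smul, Matrix.det_one, mul_one] at h1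
    exact left_ne_zero_of_mul (h1 ▸ pow_ne_zero _ (denom_ne_zero b))
  have h2 := Matrix.eq_zero_of_mulVec_eq_zero hA (v := fun u => sgn b u • actHom u h) (by
    ext1 v
    rw [Pi.zero_apply, ← hh v, antisym_apply]
    exact Finset.sum_congr rfl fun u _ => by rw [map_mul, mul_smul_comm])
  simpa using congrFun h2 1

theorem IsDualKLS.unique {g h : P.weylGroup → CT L} (hg : IsDualKLS b g) (hh : IsDualKLS b h) :
    g = h := by
  rw [isDualKLS_iff] at hg hh
  ext1 w
  rw [← sub_eq_zero]
  refine eq_zero_of_forall_antisym_fKLS_mul (b := b) fun v => ?_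
  rw [mul_sub, antisym_sub, hg, hh, sub_self]

theorem IsDualKLS.mem_hullSpan {g : P.weylGroup → CT L} (hg : IsDualKLS b g) (w : P.weylGroup) :
    g w ∈ hullSpan b (omega b (rightDescent b w)) := by
  obtain ⟨h, hh, hh'⟩ := exists_isDualKLS b
  rw [hg.unique hh]
  exact hh' w

end Basis

end

end KLS

namespace KLS

noncomputable section

variable {ι L L' : Type*} [AddCommGroup L] [AddCommGroup L'] {P : RootDatum ι L L'} {b : P.Base}

/-! ### Combinations of Weyl characters -/

section CloseCombination

variable [Finite ι] [P.IsReduced] [IsSimplyConnected P] [Module.Free ℤ L]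

variable (b) in
/-- The group of finite integer combinations of Weyl characters close to `ν`. -/
def closeCombinations (ν : L) (c : ℝ) : AddSubgroup (FractionRing (CT L)) where
  carrier := {M | IsCloseCombination b M ν c}
  zero_mem' := ⟨0, by simp, by simp⟩
  add_mem' := by
    classical
    rintro _ _ ⟨r, hr, rfl⟩ ⟨r', hr', rfl⟩
    refine ⟨r + r', fun x hx => ?_, ?_⟩
    · rcases Finset.mem_union.mp (Finsupp.support_add hx) with h | h
      · exact hr x h
      · exact hr' x h
    · exact (Finsupp.sum_add_index' (h := fun x n => n • weylChar b x) (fun _ => zero_smul _ _)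
        fun _ _ _ => add_smul _ _ _).symm
  neg_mem' := by
    rintro _ ⟨r, hr, rfl⟩
    refine ⟨-r, fun x hx => hr x (by rwa [Finsupp.support_neg] at hx), ?_⟩
    refine Eq.trans ?_ (Finsupp.sum_neg_index
      (h := fun x n => n • weylChar b x) fun _ => zero_smul _ _).symm
    simp [Finsupp.sum, Finset.sum_neg_distrib]

theorem weylChar_mem_closeCombinations {ν x y : L} {c : ℝ} (hx : Dominant b x)
    (hy : Dominant b y) (h0 : DomLE b 0 (1 ⊗ₜ y)) (hc : DomLE b (1 ⊗ₜ y) (c • (1 ⊗ₜ rho b)))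
    (w : P.weylGroup) (h : x - ν = w • y) : weylChar b x ∈ closeCombinations b ν c := by
  classical
  refine ⟨Finsupp.single x 1, fun z hz => ?_, ?_⟩
  · obtain rfl := Finset.mem_singleton.mp (Finsupp.support_single_subset hz)
    exact ⟨hx, y, hy, h0, hc, w, h⟩
  · exact ((Finsupp.sum_single_index (h := fun x n => n • weylChar b x) (zero_smul _ _)).trans
      (one_smul _ _)).symm

/-! ### Passage to the real dominance order -/

theorem exists_nonneg_of_mem_ratCone {x : L} (h : x ∈ ratCone b) :
    ∃ c : b.support → ℝ, (∀ i, 0 ≤ c i) ∧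
      (1 : ℝ) ⊗ₜ[ℤ] x = ∑ i, c i • ((1 : ℝ) ⊗ₜ[ℤ] P.root i) := by
  obtain ⟨n, hn, h⟩ := h
  obtain ⟨m, hm⟩ := exists_nat_of_mem_simpleCone h
  have hn' : (n : ℝ) ≠ 0 := by positivity
  have h1 : ∀ (k : ℕ) (y : L), (1 : ℝ) ⊗ₜ[ℤ] (k • y) = (k : ℝ) • ((1 : ℝ) ⊗ₜ[ℤ] y) := by
    intro k y
    rw [TensorProduct.tmul_smul, Nat.cast_smul_eq_nsmul]
  refine ⟨fun i => (n : ℝ)⁻¹ * m i, fun i => by positivity, ?_⟩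
  rw [← inv_smul_smul₀ hn' ((1 : ℝ) ⊗ₜ[ℤ] x), ← h1, hm, TensorProduct.tmul_sum, Finset.smul_sum]
  exact Finset.sum_congr rfl fun i _ => by rw [h1, mul_smul]

theorem domLE_zero_of_mem_ratCone {x : L} (h : x ∈ ratCone b) : DomLE b 0 (1 ⊗ₜ x) := by
  rw [DomLE, sub_zero]
  exact exists_nonneg_of_mem_ratCone h

theorem domLE_smul_rho {y : L} (h : rho b + rho b - y ∈ ratCone b) {c : ℝ} (hc : 2 ≤ c) :
    DomLE b (1 ⊗ₜ y) (c • (1 ⊗ₜ rho b)) := by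
  obtain ⟨m, hm, h1⟩ := exists_nonneg_of_mem_ratCone h
  obtain ⟨n, hn, h2⟩ := exists_nonneg_of_mem_ratCone (dominant_rho b).mem_ratCone
  refine ⟨fun i => (c - 2) * n i + m i,
    fun i => add_nonneg (mul_nonneg (sub_nonneg.mpr hc) (hn i)) (hm i), ?_⟩
  simp only [add_smul, mul_smul, Finset.sum_add_distrib, ← Finset.smul_sum]
  rw [← h1, ← h2, TensorProduct.tmul_sub, TensorProduct.tmul_add]
  module

open Classical in
theorem antisym_div_denom_mem {I : Finset b.support} {q : ℕ} {c : ℝ} (hc : 2 ≤ c)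
    (y : P.weylGroup) {z : L} (hz : z ∈ hull b (omega b Iᶜ)) :
    algebraMap (CT L) (FractionRing (CT L)) (antisym b (ex (q • (y • omega b I)) * ex z)) /
      algebraMap (CT L) (FractionRing (CT L)) (denom b) ∈
      closeCombinations b (((q : ℤ) - 1) • omega b I) c := by
  rw [ex_mul_ex]
  obtain ⟨t, ht⟩ := exists_dominant_smul b (q • (y • omega b I) + z)
  rw [antisym_ex_eq b t]
  set τ := t • (q • (y • omega b I) + z) with hτ
  by_cases h0 : antisym b (ex τ) = 0
  · rw [h0, smul_zero, map_zero, zero_div]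
    exact zero_mem _
  have hd := ht.sub_rho h0
  rw [map_zsmul, smul_div_assoc]
  refine zsmul_mem ?_ _
  have hw : algebraMap (CT L) (FractionRing (CT L)) (antisym b (ex τ)) /
      algebraMap (CT L) (FractionRing (CT L)) (denom b) = weylChar b (τ - rho b) := by
    rw [weylChar, sub_add_cancel]
  rw [hw]
  have h1 : τ - (t * y) • (q • omega b I) ∈ hull b (omega b Iᶜ) := by
    have h2 : τ - (t * y) • (q • omega b I) = t • z := by
      rw [hτ, smul_add, mul_smul, smul_comm y q, add_sub_cancel_left]
    rw [h2]
    exact smul_mem_hull hz t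
  -- The exponent differs from a conjugate of q ω_I by an element of the hull; since τ is dominant,
  -- that conjugate may be replaced by q ω_I.
  have h2 := sub_mem_hull_of_sub_smul_mem ht ((dominant_omega b I).nsmul q) _ h1
  have h3 : τ - q • omega b I ∈ hull b (rho b) := by
    refine hull_mono ?_ h2
    rw [← omega_add_omega_compl b I, add_sub_cancel_right]
    exact (dominant_omega b I).mem_ratCone
  -- Since ρ is ω_I plus the complementary sum, subtracting ρ from τ and (q-1) ω_I from the result
  -- amounts to subtracting q ω_I and that sum. Each of the two parts costs at most ρ, whence the
  -- bound 2ρ.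
  have h4 := add_mem_hull h3 (neg_mem_hull_rho (omega_mem_hull_rho Iᶜ))
  have h5 : τ - q • omega b I + -omega b Iᶜ = τ - rho b - ((q : ℤ) - 1) • omega b I := by
    rw [← omega_add_omega_compl b I, sub_smul, one_smul, natCast_zsmul]
    abel
  rw [h5] at h4
  obtain ⟨u, hu⟩ := exists_dominant_smul b (τ - rho b - ((q : ℤ) - 1) • omega b I)
  exact weylChar_mem_closeCombinations hd hu (domLE_zero_of_mem_ratCone hu.mem_ratCone)
    (domLE_smul_rho (sub_mem_of_mem_hull (smul_mem_hull h4 u)) hc) u⁻¹ (inv_smul_smul u _).symm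

/-- `[q]^*`, as an additive homomorphism. -/
def frobHom (q : ℕ) : CT L →+ CT L :=
  (AddMonoidAlgebra.mapDomainRingHom ℂ (DistribSMul.toAddMonoidHom L q)).toAddMonoidHom

theorem frobHom_apply (q : ℕ) (f : CT L) : frobHom q f = frob q f := rfl

theorem frob_ex (q : ℕ) (x : L) : frob q (ex x) = ex (q • x) :=
  AddMonoidAlgebra.mapDomain_single

theorem frob_fKLS (q : ℕ) (v : P.weylGroup)
    [Fintype (P.weylGroup ⧸ parabolic b (rightDescent b v))] :
    open Classical in frob q (fKLS b v) = ∑ c : P.weylGroup ⧸ parabolic b (rightDescent b v),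
      (klP b c.out v).eval 1 • ex (q • (c.out • omega b (rightDescent b v)ᶜ)) := by
  rw [fKLS_eq, ← frobHom_apply, map_sum]
  exact Finset.sum_congr rfl fun c _ => by rw [map_zsmul, frobHom_apply, frob_ex]

theorem elemM_mem_closeCombinations {fstar : P.weylGroup → CT L} (hf : IsDualKLS b fstar) (q : ℕ)
    {c : ℝ} (hc : 2 ≤ c) {d u : P.weylGroup} (h : IsDuflo b d u) :
    elemM b fstar q d u ∈ closeCombinations b (((q : ℤ) - 1) • omega b (rightDescent b u)) c := by
  classical
  have := Fintype.ofFinite (P.weylGroup ⧸ parabolic b (rightDescent b (longest b * d)))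
  -- Of the Duflo property only membership in the left cell of u enters: it fixes the orbit on which
  -- f_{w₀ d} is supported.
  have hI : (rightDescent b (longest b * d))ᶜ = rightDescent b u := by
    rw [rightDescent_longest_mul, compl_compl, h.1.rightDescent_eq]
  have hg := hf.mem_hullSpan (longest b * u)
  rw [rightDescent_longest_mul] at hg
  rw [elemM]
  generalize fstar (longest b * u) = g at hg
  induction hg using AddSubgroup.closure_induction with
  | zero => rw [pairing, mul_zero, antisym_zero, map_zero, zero_div]; exact zero_mem _
  | add g g' _ _ hg hg' =>
    rw [pairing, mul_add, antisym_add, map_add, add_div]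
    exact add_mem hg hg'
  | neg g _ hg =>
    rw [← neg_one_zsmul, pairing, mul_smul_comm, antisym_zsmul, map_zsmul, smul_div_assoc]
    exact zsmul_mem hg _
  | mem g hg =>
    obtain ⟨z, hz, rfl⟩ := hg
    rw [pairing, frob_fKLS, hI, Finset.sum_mul, antisym_sum, map_sum, Finset.sum_div]
    refine sum_mem fun x _ => ?_
    rw [smul_mul_assoc, antisym_zsmul, map_zsmul, smul_div_assoc]
    exact zsmul_mem (antisym_div_denom_mem hc _ hz) _

/-! ### Positivity of an invariant form -/

variable {B : LinearMap.BilinForm ℝ (ℝ ⊗[ℤ] L)}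

theorem IsInvariantInner.self_nonneg (hB : IsInvariantInner P B) (x : ℝ ⊗[ℤ] L) : 0 ≤ B x x := by
  by_cases h : x = 0
  · simp [h]
  · exact (hB.pos x h).le

/-- Invariance under s_i gives (ρ, α_i) = (ρ - α_i, -α_i), that is, 2(ρ, α_i) = (α_i, α_i). -/
theorem IsInvariantInner.rho_simple_nonneg (hB : IsInvariantInner P B) (i : b.support) :
    0 ≤ B (1 ⊗ₜ rho b) (1 ⊗ₜ P.root i) := by
  have h := hB.invariant (simpleRefl b i) (rho b) (P.root i)
  have h1 : P.toLinearMap (P.root i) (P.coroot i) = 2 := P.root_coroot_two i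
  rw [simpleRefl_smul, simpleRefl_smul, rho_coroot, h1, one_smul, two_smul, sub_add_cancel_left,
    TensorProduct.tmul_neg, TensorProduct.tmul_sub, map_neg, map_sub, LinearMap.sub_apply] at h
  have := hB.self_nonneg (1 ⊗ₜ P.root i)
  linarith

theorem IsInvariantInner.rho_nonneg (hB : IsInvariantInner P B) {x : L} (hx : Dominant b x) :
    0 ≤ B (1 ⊗ₜ rho b) (1 ⊗ₜ x) := by
  obtain ⟨c, hc, h⟩ := exists_nonneg_of_mem_ratCone hx.mem_ratCone
  rw [h, map_sum]
  refine Finset.sum_nonneg fun i _ => ?_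
  rw [map_smul]
  exact mul_nonneg (hc i) (hB.rho_simple_nonneg i)

end CloseCombination

end

end KLS

/-! ### The theorem -/

open Classical in
theorem mainTheorem3 {ι L L' : Type*} [Finite ι] [AddCommGroup L] [AddCommGroup L']
    [Module.Free ℤ L] [Module.Finite ℤ L] (P : RootDatum ι L L') [P.IsReduced]
    [KLS.IsSimplyConnected P] (b : P.Base) :
    (∃! fstar : P.weylGroup → KLS.CT L, KLS.IsDualKLS b fstar) ∧
    ∀ fstar : P.weylGroup → KLS.CT L, KLS.IsDualKLS b fstar →
    ∀ B : LinearMap.BilinForm ℝ (TensorProduct ℤ ℝ L), KLS.IsInvariantInner P B →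
    ∀ q : ℕ, IsPrimePow q →
      (∀ w d : P.weylGroup, KLS.IsDuflo b d (KLS.longest b * w) →
        KLS.IsCloseCombination b (KLS.elemM b fstar q d (KLS.longest b * w))
          (((q : ℤ) - 1) • KLS.omega b (KLS.rightDescent b w)ᶜ)
          (2 * (KLS.height b B w + 1))) ∧
      (∀ w d : P.weylGroup, KLS.IsDuflo b d w →
        KLS.IsCloseCombination b (KLS.elemM b fstar q d w)
          (((q : ℤ) - 1) • KLS.omega b (KLS.rightDescent b w))
          (2 * B (TensorProduct.tmul ℤ 1 (KLS.rho b)) (TensorProduct.tmul ℤ 1 (KLS.rho b)) + 2)) := by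
  obtain ⟨g, hg, -⟩ := KLS.exists_isDualKLS (b := b)
  refine ⟨⟨g, hg, fun h hh => hh.unique hg⟩, fun fstar hf B hB q _ => ⟨fun w d hd => ?_,
    fun w d hd => ?_⟩⟩
  -- Both parts are the same estimate. Here it is applied to w₀ w, whose right descent set is the
  -- complement of that of w, and h(w) ≥ 0 makes the constant at least 2.
  · have h0 : 0 ≤ KLS.height b B w := hB.rho_nonneg (KLS.dominant_omega b _)
    have := KLS.elemM_mem_closeCombinations hf q (c := 2 * (KLS.height b B w + 1))
      (by linarith) hd
    rwa [KLS.rightDescent_longest_mul] at this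
  · have h0 := hB.self_nonneg (TensorProduct.tmul ℤ 1 (KLS.rho b))
    exact KLS.elemM_mem_closeCombinations hf q (by linarith) hd
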